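/- All Hilbert spaces are finite-dimensional, all alphabets are finite, and $\log=\log_2$. A state is a positive semidefinite operator of trace one. A cq-state is a state of the form $\rho_{XE}=\sum_{x\in\mathcal X}P_X(x)\,|x\rangle\langle x|\otimes\rho_E^x$, with $P_X$ a probability distribution, $(|x\rangle)_{x\in\mathcal X}$ an orthonormal basis of the register $X$, and every $\rho_E^x$ a state. For $\rho_{AB}\ge 0$ put $$H_\infty(A|B)_\rho=-\log\min\{\operatorname{Tr}\sigma_B:\ \sigma_B\ge 0,\ \rho_{AB}\le \mathrm{id}_A\otimes\sigma_B\}\in(-\infty,+\infty],$$ with $-\log 0=+\infty$. Put $F(\rho,\tau)=\|\sqrt\rho\sqrt\tau\|_1$, where $\|M\|_1=\operatorname{Tr}\sqrt{M^\dagger M}$, and $C(\rho,\tau)=\sqrt{1-F(\rho,\tau)^2}$. For $\varepsilon\ge 0$, the smooth min-entropy is $$H_\infty^{\varepsilon}(A|B)_\rho=\sup\{H_\infty(A|B)_{\hat\rho}:\ \hat\rho_{AB}\ge 0,\ \operatorname{Tr}\hat\rho_{AB}\le 1,\ C(\rho_{AB},\hat\rho_{AB})\le\varepsilon\}.$$ **Lemma.**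 Let $\varepsilon\ge 0$ and $\alpha\in\mathbb R$, and let $\rho_{X_0E_0}$ and $\rho_{X_1E_1}$ be two independent cq-states, that is, with joint state $\rho_{X_0X_1E_0E_1}=\rho_{X_0E_0}\otimes\rho_{X_1E_1}$, such that $$H_\infty^{\varepsilon^2}(X_0X_1|E_0E_1)\ge\alpha .$$ Let $S_0,S_1$ be classical random variables over $\{0,1\}^\ell$, arbitrarily correlated with these systems: $\rho_{X_0X_1S_0S_1E_0E_1}$ is any cq-state (classical on $X_0X_1S_0S_1$, quantum on $E_0E_1$) that reduces to $\rho_{X_0E_0}\otimes\rho_{X_1E_1}$ when $S_0S_1$ is traced out. Then there is a bit $D\in\{0,1\}$ (a constant, hence in particular a random variable) such that, with $\overline D=1-D$, $$H_\infty^{\varepsilon}(X_{\overline D}\,D\,S_D\,|\,E_0E_1)\ge\alpha/2 .$$ Here the classical registers $X_{\overline D}\,D\,S_D$ together take values in $(\mathcal X_0\sqcup\mathcal X_1)\times\{0,1\}\times\{0,1\}^\ell$. -/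

import Mathlib

open scoped ComplexOrder MatrixOrder Kronecker

noncomputable section

/-! Operators on a finite-dimensional Hilbert space are written as complex matrices over an
orthonormal basis indexed by a finite type; the composite of systems with bases `A` and `B`
has basis `A × B`, with the classical register (if there is one) on the left. -/

/-- A quantum state: a positive semidefinite operator of trace one. -/
def IsState {A : Type*} [Fintype A] (ρ : Matrix A A ℂ) : Prop :=
  ρ.PosSemidef ∧ ρ.trace = 1

/-- A cq-state `ρ_XE = ∑ₓ P_X(x) |x⟩⟨x| ⊗ ρ_E^x`, with `P_X` a probability distribution on `X`
and every `ρ_E^x` a state. -/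
def IsCQState {X E : Type*} [Fintype X] [DecidableEq X] [Fintype E]
    (ρ : Matrix (X × E) (X × E) ℂ) : Prop :=
  ∃ (P : X → ℝ) (ρE : X → Matrix E E ℂ), (∀ x, 0 ≤ P x) ∧ ∑ x, P x = 1 ∧
    (∀ x, IsState (ρE x)) ∧
    ρ = ∑ x, (P x : ℂ) • (Matrix.single x x (1 : ℂ) ⊗ₖ ρE x)

/-- The state `ρ_{f(X)E}` that results when the classical register `X` of `ρ_XE` is processed by
the function `f`: the term `|x⟩⟨x| ⊗ P_X(x) ρ_E^x` becomes `|f x⟩⟨f x| ⊗ P_X(x) ρ_E^x`.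
For a projection `f` this traces out the other classical registers. -/
def mapClassical {X Y E : Type*} [Fintype X] [DecidableEq Y] (f : X → Y)
    (ρ : Matrix (X × E) (X × E) ℂ) : Matrix (Y × E) (Y × E) ℂ :=
  ∑ x, Matrix.single (f x) (f x) (1 : ℂ) ⊗ₖ (Matrix.of fun e e' => ρ (x, e) (x, e'))

/-- The joint state `ρ_{A₀B₀} ⊗ ρ_{A₁B₁}` of two independent bipartite systems, with the systems
arranged in the order `A₀ A₁ B₀ B₁`. -/
def indepState {A₀ A₁ B₀ B₁ : Type*} (ρ₀ : Matrix (A₀ × B₀) (A₀ × B₀) ℂ)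
    (ρ₁ : Matrix (A₁ × B₁) (A₁ × B₁) ℂ) :
    Matrix ((A₀ × A₁) × (B₀ × B₁)) ((A₀ × A₁) × (B₀ × B₁)) ℂ :=
  Matrix.reindex (Equiv.prodProdProdComm A₀ B₀ A₁ B₁) (Equiv.prodProdProdComm A₀ B₀ A₁ B₁)
    (ρ₀ ⊗ₖ ρ₁)

/-- The `L₁`-norm `‖M‖₁ = Tr √(M† M)`. -/
def traceNorm {A : Type*} [Fintype A] [DecidableEq A] (M : Matrix A A ℂ) : ℝ :=
  (CFC.sqrt (M.conjTranspose * M)).trace.re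

/-- The fidelity `F(ρ, σ) = ‖√ρ √σ‖₁`. -/
def fidelity {A : Type*} [Fintype A] [DecidableEq A] (ρ σ : Matrix A A ℂ) : ℝ :=
  traceNorm (CFC.sqrt ρ * CFC.sqrt σ)

/-- The distance `C(ρ, σ) = √(1 - F(ρ, σ)²)`. -/
def cDist {A : Type*} [Fintype A] [DecidableEq A] (ρ σ : Matrix A A ℂ) : ℝ :=
  √(1 - fidelity ρ σ ^ 2)

/-- The ball `K^ε(ρ)` of positive operators of trace at most one that are `ε`-close to `ρ`. -/
def smoothingBall {A : Type*} [Fintype A] [DecidableEq A] (ε : ℝ) (ρ : Matrix A A ℂ) :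
    Set (Matrix A A ℂ) :=
  {τ | τ.PosSemidef ∧ cDist ρ τ ≤ ε ∧ τ.trace.re ≤ 1}

/-- The optimal value `min Tr(σ_B)` over `σ_B ≥ 0` with `ρ_AB ≤ id_A ⊗ σ_B`. -/
def minEntropyValue {A B : Type*} [DecidableEq A] [Fintype B]
    (ρ : Matrix (A × B) (A × B) ℂ) : ℝ :=
  sInf {t : ℝ | ∃ σ : Matrix B B ℂ, σ.PosSemidef ∧
    ((1 : Matrix A A ℂ) ⊗ₖ σ - ρ).PosSemidef ∧ t = σ.trace.re}

/-- The conditional min-entropy `H_∞(A|B)_ρ = -log₂ min Tr(σ_B)`; it is `+∞` if the minimum is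
zero, which happens for `ρ = 0`. -/
def minEntropy {A B : Type*} [DecidableEq A] [Fintype B]
    (ρ : Matrix (A × B) (A × B) ℂ) : EReal :=
  if minEntropyValue ρ = 0 then ⊤ else ((-Real.logb 2 (minEntropyValue ρ) : ℝ) : EReal)

/-- The `ε`-smooth conditional min-entropy `H_∞^ε(A|B)_ρ`. -/
def smoothMinEntropy {A B : Type*} [Fintype A] [DecidableEq A] [Fintype B] [DecidableEq B]
    (ε : ℝ) (ρ : Matrix (A × B) (A × B) ℂ) : EReal :=
  ⨆ τ ∈ smoothingBall ε ρ, minEntropy τ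

/-- The string `S` ranges over `{0,1}^ℓ`. -/
abbrev BitString (ℓ : ℕ) : Type := Fin ℓ → Bool

/-- The value of the registers `(X_{D̄}, D, S_D)` when `D = d`, as a function of the registers
`X₀ X₁ S₀ S₁`; the bit `0` is `false` and `1` is `true`. -/
def selectRegisters {X₀ X₁ S : Type*} (d : Bool) (z : (X₀ × X₁) × (S × S)) :
    (X₀ ⊕ X₁) × Bool × S :=
  match d with
  | false => (Sum.inr z.1.2, false, z.2.1)
  | true => (Sum.inl z.1.1, true, z.2.2)

end

/-! Write `C = √(1 - F²)`. Every positive definite `K` gives `F(ρ,τ)² ≤ Tr(ρ K⁻¹) Tr(τ K)`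
(`fidelity_sq_le`). If `K = M + q` with `λ Tr_A M ≤ 1 - q`, then `Tr(τ K) ≤ 1` for every
subnormalised `τ ≤ 1 ⊗ σ` with `Tr σ ≤ λ`, so `Tr(ρ K⁻¹)` bounds `F²` for all these `τ`.

The bound is tight up to an arbitrarily small loss in `λ`. In `exists_feasible_or_dual` the function
`Tr(ρ K⁻¹)` is minimised over such `K`. If the minimum `f` is at least `1 - ε²`, first-order
optimality and semidefinite duality turn `K⁻¹ ρ K⁻¹ / f` into a smoothed state of the form `Z ρ Z`
with large min-entropy. Otherwise `K` is a certificate with `Tr(ρ K⁻¹) < 1 - ε²`.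

Certificates multiply: `M₀ ⊗ M₁ + q` with `1 - q = (1 - q₀)(1 - q₁)` is a certificate for `λ²`, with
value at most `1 - (1 - a₀)(1 - a₁)`, where `aᵢ` are the single-system values
(`re_trace_mul_inv_joint_le`). If both systems had certificates at `λ` slightly above `2^(-α/2)`,
every candidate `τ` for the joint system would satisfy `F² < 1 - ε⁴`, contradicting the hypothesis
with smoothing `ε²`.

So one system has a good `Z`, and the constant `D` is chosen to keep that system's `X`. Acting with
`Z ⊗ 1` carries the smoothing over to `S_D` and the other side system: a classical register
satisfies `ρ_{XSE} ≤ ρ_{XE} ⊗ 1_S`, the other side system is independent, and the fidelity `Tr(ρ Z)`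
is unchanged (`le_smoothMinEntropy_of_adjoin`). -/

section Fidelity

/-! ### Positive matrices, trace norm and fidelity. -/

namespace Matrix

variable {n m : Type*} [Fintype n] [Fintype m]

/-- Positive semidefinite matrices have nonnegative real trace. -/
theorem PosSemidef.re_trace_nonneg {A : Matrix n n ℂ} (hA : A.PosSemidef) : 0 ≤ A.trace.re :=
  (Complex.le_def.1 hA.trace_nonneg).1

omit [Fintype n] in
theorem PosSemidef.real_smul {A : Matrix n n ℂ} (hA : A.PosSemidef) {c : ℝ} (hc : 0 ≤ c) :
    (c • A).PosSemidef := hA.smul hc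

theorem re_trace_smul (c : ℝ) (A : Matrix n n ℂ) : (c • A).trace.re = c * A.trace.re := by
  rw [trace_smul, Complex.smul_re, smul_eq_mul]

variable [DecidableEq n] [DecidableEq m]

theorem sqrt_posSemidef (A : Matrix n n ℂ) : (CFC.sqrt A).PosSemidef :=
  nonneg_iff_posSemidef.1 (CFC.sqrt_nonneg A)

theorem PosSemidef.sqrt_mul_sqrt {A : Matrix n n ℂ} (hA : A.PosSemidef) :
    CFC.sqrt A * CFC.sqrt A = A :=
  CFC.sqrt_mul_sqrt_self A (nonneg_iff_posSemidef.2 hA)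

theorem conjTranspose_sqrt (A : Matrix n n ℂ) : (CFC.sqrt A)ᴴ = CFC.sqrt A :=
  (sqrt_posSemidef A).1

theorem PosSemidef.re_trace_mul_nonneg {A B : Matrix n n ℂ} (hA : A.PosSemidef)
    (hB : B.PosSemidef) : 0 ≤ (A * B).trace.re := by
  have h := (hB.conjTranspose_mul_mul_same (CFC.sqrt A)).re_trace_nonneg
  rwa [conjTranspose_sqrt, Matrix.trace_mul_cycle, hA.sqrt_mul_sqrt] at h

omit [DecidableEq n] in
theorem re_trace_conjTranspose (A : Matrix n n ℂ) : Aᴴ.trace.re = A.trace.re := by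
  rw [trace_conjTranspose]; simp

/-- A positive semidefinite matrix is dominated by its trace. -/
theorem PosSemidef.trace_smul_one_sub {A : Matrix n n ℂ} (hA : A.PosSemidef) :
    (A.trace.re • (1 : Matrix n n ℂ) - A).PosSemidef := by
  rw [← le_iff]
  have : A ≤ algebraMap ℝ _ A.trace.re := by
    apply le_algebraMap_of_spectrum_le _ hA.1
    intro x hx
    rw [hA.1.spectrum_real_eq_range_eigenvalues] at hx
    obtain ⟨i, rfl⟩ := hx
    rw [hA.1.trace_eq_sum_eigenvalues]
    simp only [Complex.coe_algebraMap, Complex.re_sum, Complex.ofReal_re]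
    have := Finset.single_le_sum (f := hA.1.eigenvalues) (fun j _ => hA.eigenvalues_nonneg j)
      (Finset.mem_univ i)
    simpa using this
  rwa [Algebra.algebraMap_eq_smul_one] at this

/-- The trace of `f(A)` is the sum of `f` over the characteristic roots. This compares `√(M Mᴴ)`
with `√(Mᴴ M)`, which differ as matrices. -/
theorem trace_cfc_eq_of_charpoly_eq {A B : Matrix n n ℂ} (hA : A.IsHermitian) (hB : B.IsHermitian)
    (h : A.charpoly = B.charpoly) (f : ℝ → ℝ) : (cfc f A).trace = (cfc f B).trace := by
  have key : ∀ {C : Matrix n n ℂ} (hC : C.IsHermitian),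
      (cfc f C).trace = (C.charpoly.roots.map fun z => ((f z.re : ℝ) : ℂ)).sum := by
    intro C hC
    have h2 : (cfc f C).trace = ∑ i, ((f (hC.eigenvalues i) : ℝ) : ℂ) := by
      rw [trace_eq_sum_roots_charpoly, hC.charpoly_cfc_eq]
      rw [Polynomial.roots_prod _ _ (Finset.prod_ne_zero_iff.2 fun i _ =>
        Polynomial.X_sub_C_ne_zero _)]
      simp
    rw [h2, hC.roots_charpoly_eq_eigenvalues, Multiset.map_map]
    simp
  rw [key hA, key hB, h]

end Matrix

open Matrix

variable {A : Type*} [Fintype A] [DecidableEq A]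

theorem traceNorm_conjTranspose (M : Matrix A A ℂ) : traceNorm Mᴴ = traceNorm M := by
  unfold traceNorm
  rw [conjTranspose_conjTranspose]
  have h1 := posSemidef_self_mul_conjTranspose M
  have h2 := posSemidef_conjTranspose_mul_self M
  rw [CFC.sqrt_eq_real_sqrt _ (nonneg_iff_posSemidef.2 h1),
    CFC.sqrt_eq_real_sqrt _ (nonneg_iff_posSemidef.2 h2), cfcₙ_eq_cfc, cfcₙ_eq_cfc,
    trace_cfc_eq_of_charpoly_eq h1.1 h2.1 (charpoly_mul_comm _ _)]

theorem fidelity_comm (ρ τ : Matrix A A ℂ) : fidelity ρ τ = fidelity τ ρ := by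
  unfold fidelity
  rw [← traceNorm_conjTranspose, conjTranspose_mul, conjTranspose_sqrt, conjTranspose_sqrt]

/-- `√ρ Z ρ Z √ρ` is the square of the positive matrix `√ρ Z √ρ`, so the root disappears. Seeking
smoothed states as `Z ρ Z` thus makes the fidelity linear in `Z`. -/
theorem fidelity_mul_mul_self {ρ Z : Matrix A A ℂ} (hρ : ρ.PosSemidef) (hZ : Z.PosSemidef) :
    fidelity ρ (Z * ρ * Z) = (ρ * Z).trace.re := by
  have hτ : (Z * ρ * Z).PosSemidef := by
    simpa [hZ.1.eq] using hρ.conjTranspose_mul_mul_same Z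
  rw [fidelity_comm]
  unfold fidelity traceNorm
  rw [conjTranspose_mul, conjTranspose_sqrt, conjTranspose_sqrt]
  have hS : (CFC.sqrt ρ * Z * CFC.sqrt ρ).PosSemidef := by
    simpa [conjTranspose_sqrt] using hZ.conjTranspose_mul_mul_same (CFC.sqrt ρ)
  have h : CFC.sqrt ρ * CFC.sqrt (Z * ρ * Z) * (CFC.sqrt (Z * ρ * Z) * CFC.sqrt ρ)
      = (CFC.sqrt ρ * Z * CFC.sqrt ρ) * (CFC.sqrt ρ * Z * CFC.sqrt ρ) := by
    calc _ = CFC.sqrt ρ * (CFC.sqrt (Z * ρ * Z) * CFC.sqrt (Z * ρ * Z)) * CFC.sqrt ρ := by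
          simp only [mul_assoc]
      _ = CFC.sqrt ρ * Z * (CFC.sqrt ρ * CFC.sqrt ρ) * Z * CFC.sqrt ρ := by
          rw [hτ.sqrt_mul_sqrt, hρ.sqrt_mul_sqrt]; simp only [mul_assoc]
      _ = _ := by simp only [mul_assoc]
  rw [h, CFC.sqrt_mul_self _ (nonneg_iff_posSemidef.2 hS), Matrix.trace_mul_cycle,
    hρ.sqrt_mul_sqrt]

/-- Polar decomposition, in the form used to estimate the trace norm. -/
theorem exists_contraction_traceNorm (M : Matrix A A ℂ) :
    ∃ U : Matrix A A ℂ, (1 - U * Uᴴ).PosSemidef ∧ traceNorm M = (U * M).trace.re := by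
  set N := Mᴴ * M with hN
  have hNp : N.PosSemidef := posSemidef_conjTranspose_mul_self M
  have hc : ∀ f : ℝ → ℝ, ContinuousOn f (spectrum ℝ N) := fun f =>
    Set.Finite.continuousOn (hNp.1.spectrum_real_eq_range_eigenvalues ▸ Set.finite_range _) f
  have hsp : ∀ x ∈ spectrum ℝ N, 0 ≤ x := fun x hx =>
    spectrum_nonneg_of_nonneg (nonneg_iff_posSemidef.2 hNp) hx
  have hid : cfc (fun x : ℝ => x) N = N := cfc_id' ℝ N hNp.1
  have hgsa : (cfc (fun x : ℝ => (√x)⁻¹) N)ᴴ = cfc (fun x : ℝ => (√x)⁻¹) N :=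
    (cfc_predicate (R := ℝ) _ N : IsSelfAdjoint _)
  -- `U = N^(-1/2) Mᴴ`; the convention `0⁻¹ = 0` makes `N^(-1/2)` vanish on the kernel, so `U` is a
  -- contraction for singular `M` too.
  refine ⟨cfc (fun x : ℝ => (√x)⁻¹) N * Mᴴ, ?_, ?_⟩
  · rw [conjTranspose_mul, conjTranspose_conjTranspose, hgsa]
    have : cfc (fun x : ℝ => (√x)⁻¹) N * Mᴴ * (M * cfc (fun x : ℝ => (√x)⁻¹) N)
        = cfc (fun x : ℝ => (√x)⁻¹ * x * (√x)⁻¹) N := by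
      rw [cfc_mul _ _ N (hc _) (hc _), cfc_mul _ _ N (hc _) (hc _), hid, hN]
      simp only [mul_assoc]
    rw [this, ← le_iff]
    apply cfc_le_one
    intro x hx
    rcases (hsp x hx).eq_or_lt with h | h
    · simp [← h]
    · have : 0 < √x := Real.sqrt_pos.2 h
      have h2 := Real.sq_sqrt (hsp x hx)
      field_simp
      rw [h2]
  · unfold traceNorm
    rw [← hN, CFC.sqrt_eq_real_sqrt _ (nonneg_iff_posSemidef.2 hNp), cfcₙ_eq_cfc,
      mul_assoc, ← hN]
    have : cfc (fun x : ℝ => (√x)⁻¹) N * N = cfc (fun x : ℝ => (√x)⁻¹ * x) N := by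
      rw [cfc_mul _ _ N (hc _) (hc _), hid]
    rw [this]
    congr 2
    apply cfc_congr
    intro x hx
    rcases (hsp x hx).eq_or_lt with h | h
    · simp [← h]
    · have : 0 < √x := Real.sqrt_pos.2 h
      have h2 := Real.sq_sqrt (hsp x hx)
      simp only
      field_simp
      rw [h2]

/-- The Cauchy-Schwarz inequality for the Hilbert-Schmidt inner product. -/
theorem re_trace_mul_sq_le (P Q : Matrix A A ℂ) :
    (P * Q).trace.re ^ 2 ≤ (P * Pᴴ).trace.re * (Qᴴ * Q).trace.re := by
  have h : ∀ t : ℝ, 0 ≤ (P * Pᴴ).trace.re * (t * t) + (2 * (P * Q).trace.re) * t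
      + (Qᴴ * Q).trace.re := by
    intro t
    have h1 := (posSemidef_conjTranspose_mul_self (t • Pᴴ + Q)).re_trace_nonneg
    have h2 : (Qᴴ * Pᴴ).trace.re = (P * Q).trace.re := by
      rw [← conjTranspose_mul, re_trace_conjTranspose]
    simp only [conjTranspose_add, conjTranspose_smul, conjTranspose_conjTranspose, star_trivial,
      add_mul, mul_add, trace_add, Complex.add_re, smul_mul_assoc, mul_smul_comm,
      re_trace_smul, h2] at h1
    linarith
  have := discrim_le_zero h
  unfold discrim at this
  nlinarith

/-- Every positive definite `K` bounds the fidelity from above. -/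
theorem fidelity_sq_le {ρ τ K : Matrix A A ℂ} (hρ : ρ.PosSemidef) (hτ : τ.PosSemidef)
    (hK : K.PosDef) :
    fidelity ρ τ ^ 2 ≤ (ρ * K⁻¹).trace.re * (τ * K).trace.re := by
  obtain ⟨U, hU, hF⟩ := exists_contraction_traceNorm (CFC.sqrt ρ * CFC.sqrt τ)
  unfold fidelity
  rw [hF]
  set L := CFC.sqrt K with hL
  have hLL : L * L = K := hK.posSemidef.sqrt_mul_sqrt
  have hLs : Lᴴ = L := conjTranspose_sqrt K
  have hKi : IsUnit K.det := (Matrix.isUnit_iff_isUnit_det _).1 hK.isUnit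
  have hLi : IsUnit L.det := by
    rw [← hLL, det_mul] at hKi
    exact isUnit_of_mul_isUnit_left hKi
  have hLis : (L⁻¹)ᴴ = L⁻¹ := by rw [conjTranspose_nonsing_inv, hLs]
  -- Inserting `L⁻¹ L` with `L = √K` lets Cauchy-Schwarz split off `Tr(τ K)`.
  have h1 : U * (CFC.sqrt ρ * CFC.sqrt τ) = (U * CFC.sqrt ρ * L⁻¹) * (L * CFC.sqrt τ) := by
    calc _ = U * CFC.sqrt ρ * (L⁻¹ * L) * CFC.sqrt τ := by
          rw [nonsing_inv_mul _ hLi]; simp only [mul_assoc, one_mul]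
      _ = _ := by simp only [mul_assoc]
  rw [h1]
  refine (re_trace_mul_sq_le _ _).trans ?_
  have h2 : ((L * CFC.sqrt τ)ᴴ * (L * CFC.sqrt τ)).trace.re = (τ * K).trace.re := by
    rw [conjTranspose_mul, hLs, conjTranspose_sqrt]
    have : CFC.sqrt τ * L * (L * CFC.sqrt τ) = CFC.sqrt τ * K * CFC.sqrt τ := by
      rw [← hLL]; simp only [mul_assoc]
    rw [this, Matrix.trace_mul_cycle, hτ.sqrt_mul_sqrt]
  rw [h2]
  apply mul_le_mul_of_nonneg_right _ (hτ.re_trace_mul_nonneg hK.posSemidef)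
  have h3 : U * CFC.sqrt ρ * L⁻¹ * (U * CFC.sqrt ρ * L⁻¹)ᴴ
      = U * (CFC.sqrt ρ * K⁻¹ * CFC.sqrt ρ) * Uᴴ := by
    rw [conjTranspose_mul, conjTranspose_mul, hLis, conjTranspose_sqrt, ← hLL, Matrix.mul_inv_rev]
    simp only [mul_assoc]
  have hS : (CFC.sqrt ρ * K⁻¹ * CFC.sqrt ρ).PosSemidef := by
    simpa [conjTranspose_sqrt] using
      hK.inv.posSemidef.conjTranspose_mul_mul_same (CFC.sqrt ρ)
  -- `1 - U Uᴴ` and `1 - Uᴴ U` are the two Schur complements of one block matrix with identity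
  -- diagonal blocks.
  have hU' : (1 - Uᴴ * U).PosSemidef := by
    let := invertibleOne (α := Matrix A A ℂ)
    have h5 := (PosDef.fromBlocks₂₂ (m := A) (n := A) 1 U (D := (1 : Matrix A A ℂ))
      PosDef.one).2 (by simpa using hU)
    simpa using (PosDef.fromBlocks₁₁ (m := A) (n := A) (A := (1 : Matrix A A ℂ)) U 1
      PosDef.one).1 h5
  have h4 := hS.re_trace_mul_nonneg hU'
  rw [h3]
  rw [mul_sub, mul_one, trace_sub, Complex.sub_re, Matrix.trace_mul_cycle, hρ.sqrt_mul_sqrt] at h4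
  rw [Matrix.trace_mul_cycle, Matrix.trace_mul_comm]
  linarith

end Fidelity

/-! ### Partial trace, compactness and semidefinite duality. -/

section PartialTrace

open Matrix

section partialTrace

variable {A B : Type*} [Fintype A]

/-- The partial trace over the left tensor factor. -/
def partialTrace (M : Matrix (A × B) (A × B) ℂ) : Matrix B B ℂ :=
  of fun b b' => ∑ a, M (a, b) (a, b')

theorem partialTrace_apply (M : Matrix (A × B) (A × B) ℂ) (b b' : B) :
    partialTrace M b b' = ∑ a, M (a, b) (a, b') := rfl

theorem partialTrace_smul (c : ℝ) (M : Matrix (A × B) (A × B) ℂ) :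
    partialTrace (c • M) = c • partialTrace M := by
  ext b b'
  simp [partialTrace_apply, Finset.smul_sum]

theorem partialTrace_zero : partialTrace (0 : Matrix (A × B) (A × B) ℂ) = 0 := by
  ext b b'
  simp [partialTrace_apply]

theorem partialTrace_add (M N : Matrix (A × B) (A × B) ℂ) :
    partialTrace (M + N) = partialTrace M + partialTrace N := by
  ext b b'
  simp [partialTrace_apply, Finset.sum_add_distrib]

theorem continuous_partialTrace :
    Continuous (partialTrace : Matrix (A × B) (A × B) ℂ → Matrix B B ℂ) := by
  refine continuous_matrix fun b b' => ?_
  simp only [partialTrace_apply]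
  fun_prop

theorem partialTrace_isHermitian {M : Matrix (A × B) (A × B) ℂ}
    (hM : M.IsHermitian) : (partialTrace M).IsHermitian := by
  ext b b'
  simp only [conjTranspose_apply, partialTrace_apply, star_sum]
  exact Finset.sum_congr rfl fun a _ => hM.apply _ _

variable [Fintype B]

theorem trace_partialTrace (M : Matrix (A × B) (A × B) ℂ) :
    (partialTrace M).trace = M.trace := by
  simp only [trace, diag_apply, partialTrace_apply, Fintype.sum_prod_type]
  rw [Finset.sum_comm]

theorem trace_one_kronecker_mul [DecidableEq A] (σ : Matrix B B ℂ)
    (M : Matrix (A × B) (A × B) ℂ) :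
    (((1 : Matrix A A ℂ) ⊗ₖ σ) * M).trace = (σ * partialTrace M).trace := by
  simp only [trace, diag_apply, mul_apply, partialTrace_apply, Fintype.sum_prod_type,
    kronecker_apply, one_apply, ite_mul, one_mul, zero_mul]
  simp only [Finset.sum_ite_irrel, Finset.sum_const_zero, Finset.sum_ite_eq, Finset.mem_univ,
    if_true, Finset.mul_sum]
  rw [Finset.sum_comm]
  refine Finset.sum_congr rfl fun b _ => ?_
  rw [Finset.sum_comm]

end partialTrace

section compact

variable {n : Type*} [Fintype n] [DecidableEq n]

omit [DecidableEq n] in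
theorem isClosed_posSemidef : IsClosed {M : Matrix n n ℂ | M.PosSemidef} := by
  have : {M : Matrix n n ℂ | M.PosSemidef}
      = {M | Mᴴ = M} ∩ ⋂ x : n → ℂ, {M | 0 ≤ star x ⬝ᵥ (M *ᵥ x)} := by
    ext M
    simp [posSemidef_iff_dotProduct_mulVec, IsHermitian]
  rw [this]
  refine IsClosed.inter (isClosed_eq (by fun_prop) continuous_id) (isClosed_iInter fun x => ?_)
  exact isClosed_le continuous_const (by fun_prop)

/-- With `M = Lᴴ L`, each entry is an inner product of columns of `L`, bounded by AM-GM through two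
diagonal entries. This makes trace-bounded positive matrices a bounded set. -/
theorem Matrix.PosSemidef.norm_apply_le_trace {M : Matrix n n ℂ} (hM : M.PosSemidef) (i j : n) :
    ‖M i j‖ ≤ M.trace.re := by
  set L := CFC.sqrt M with hL
  have hLL : Lᴴ * L = M := by rw [conjTranspose_sqrt, hM.sqrt_mul_sqrt]
  have hd : ∀ k, (M k k).re = ∑ l, ‖L l k‖ ^ 2 := by
    intro k
    rw [← hLL, mul_apply, Complex.re_sum]
    refine Finset.sum_congr rfl fun l _ => ?_
    rw [conjTranspose_apply, Complex.star_def, mul_comm, Complex.mul_conj,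
      Complex.normSq_eq_norm_sq, Complex.ofReal_re]
  have hdt : ∀ k, (M k k).re ≤ M.trace.re := by
    intro k
    rw [trace, Complex.re_sum]
    exact Finset.single_le_sum (f := fun k => (M k k).re)
      (fun l _ => (Complex.le_def.1 (hM.diag_nonneg (i := l))).1) (Finset.mem_univ k)
  have h : ‖M i j‖ ≤ ∑ l, (‖L l i‖ ^ 2 + ‖L l j‖ ^ 2) / 2 := by
    conv_lhs => rw [← hLL, mul_apply]
    refine (norm_sum_le _ _).trans (Finset.sum_le_sum fun l _ => ?_)
    rw [conjTranspose_apply, norm_mul, norm_star]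
    nlinarith [sq_nonneg (‖L l i‖ - ‖L l j‖)]
  rw [← Finset.sum_div, Finset.sum_add_distrib, ← hd, ← hd] at h
  linarith [hdt i, hdt j]

omit [DecidableEq n] in
theorem continuous_re_trace : Continuous fun M : Matrix n n ℂ => M.trace.re :=
  Complex.continuous_re.comp continuous_id.matrix_trace

theorem isCompact_posSemidef_trace_le (t : ℝ) :
    IsCompact {M : Matrix n n ℂ | M.PosSemidef ∧ M.trace.re ≤ t} := by
  have hK : IsCompact (Set.univ.pi fun _ : n => Set.univ.pi fun _ : n =>
      Metric.closedBall (0 : ℂ) t) :=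
    isCompact_univ_pi fun _ => isCompact_univ_pi fun _ => isCompact_closedBall _ _
  refine IsCompact.of_isClosed_subset (s := (Set.univ.pi fun _ : n => Set.univ.pi fun _ : n =>
      Metric.closedBall (0 : ℂ) t : Set (Matrix n n ℂ))) hK ?_ ?_
  · exact isClosed_posSemidef.inter (isClosed_le continuous_re_trace continuous_const)
  · rintro M ⟨hM, ht⟩ i - j -
    rw [mem_closedBall_zero_iff]
    exact (hM.norm_apply_le_trace i j).trans ht

omit [Fintype n] [DecidableEq n] in
theorem convex_posSemidef : Convex ℝ {M : Matrix n n ℂ | M.PosSemidef} :=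
  fun _ hM _ hN _ _ ha hb _ => (hM.real_smul ha).add (hN.real_smul hb)

end compact

section duality

variable {n : Type*} [Fintype n] [DecidableEq n]

omit [DecidableEq n] in
theorem re_trace_mul_vecMulVec (H : Matrix n n ℂ) (x : n → ℂ) :
    (H * vecMulVec x (star x)).trace = star x ⬝ᵥ (H *ᵥ x) := by
  rw [mul_vecMulVec, trace_vecMulVec, dotProduct_comm]

omit [DecidableEq n] in
/-- The cone of positive semidefinite matrices is self-dual. -/
theorem posSemidef_of_re_trace_mul_nonneg {H : Matrix n n ℂ} (hH : H.IsHermitian)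
    (h : ∀ P : Matrix n n ℂ, P.PosSemidef → 0 ≤ (H * P).trace.re) : H.PosSemidef := by
  refine .of_dotProduct_mulVec_nonneg hH fun x => ?_
  have h1 := h _ (posSemidef_vecMulVec_self_star x)
  rw [re_trace_mul_vecMulVec] at h1
  refine Complex.le_def.2 ⟨h1, ?_⟩
  have h2 := hH.im_star_dotProduct_mulVec_self x
  exact h2.symm

/-- A real functional on Hermitian matrices is the trace against a Hermitian matrix. -/
theorem exists_hermitian_re_trace (f : Matrix n n ℂ →ₗ[ℝ] ℝ) :
    ∃ H : Matrix n n ℂ, H.IsHermitian ∧ ∀ X : Matrix n n ℂ, X.IsHermitian →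
      f X = (H * X).trace.re := by
  -- The entry is chosen so that `Re(G j i * z) = Re z * f(E_ij) + Im z * f(i E_ij)`.
  set G : Matrix n n ℂ := of fun j i =>
    (f (single i j 1) : ℂ) - Complex.I * (f (single i j Complex.I) : ℂ) with hG
  have hf : ∀ X, f X = (G * X).trace.re := by
    intro X
    conv_lhs => rw [matrix_eq_sum_single X]
    rw [map_sum, Finset.sum_congr rfl fun i _ => map_sum f _ _, trace, Complex.re_sum,
      Finset.sum_comm]
    refine Finset.sum_congr rfl fun j _ => ?_
    rw [diag_apply, mul_apply, Complex.re_sum]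
    refine Finset.sum_congr rfl fun i _ => ?_
    have h1 : single i j (X i j) = (X i j).re • single i j (1 : ℂ)
        + (X i j).im • single i j Complex.I := by
      rw [smul_single, smul_single, ← single_add]
      congr 1
      apply Complex.ext <;> simp
    rw [h1, map_add, map_smul, map_smul]
    simp [hG]
    ring
  refine ⟨(1 / 2 : ℝ) • (G + Gᴴ), ?_, fun X hX => ?_⟩
  · rw [IsHermitian, conjTranspose_smul, conjTranspose_add, conjTranspose_conjTranspose, add_comm]
    simp
  · have h2 : (Gᴴ * X).trace.re = (G * X).trace.re := by
      rw [← re_trace_conjTranspose, conjTranspose_mul, conjTranspose_conjTranspose, hX.eq,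
        trace_mul_comm]
    rw [smul_mul_assoc, re_trace_smul, add_mul, trace_add, Complex.add_re, h2, hf]
    ring

variable {A B : Type*} [Fintype A] [Fintype B] [DecidableEq A] [DecidableEq B]

omit [Fintype A] [Fintype B] [DecidableEq B] in
theorem continuous_one_kronecker :
    Continuous fun σ : Matrix B B ℂ => (1 : Matrix A A ℂ) ⊗ₖ σ := by
  refine continuous_pi fun i => continuous_pi fun j => ?_
  change Continuous fun σ : Matrix B B ℂ => (1 : Matrix A A ℂ) i.1 j.1 * σ i.2 j.2
  fun_prop

/-- Semidefinite programming duality for the conditional min-entropy. -/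
theorem exists_dominating_of_dual {τ : Matrix (A × B) (A × B) ℂ} (hτ : τ.PosSemidef) {κ : ℝ}
    (hκ : 0 < κ)
    (h : ∀ M : Matrix (A × B) (A × B) ℂ, M.PosSemidef → (1 - partialTrace M).PosSemidef →
      (τ * M).trace.re ≤ κ) :
    ∃ σ : Matrix B B ℂ, σ.PosSemidef ∧ ((1 : Matrix A A ℂ) ⊗ₖ σ - τ).PosSemidef ∧
      σ.trace.re ≤ κ := by
  by_contra hcon
  push Not at hcon
  set Ω := {σ : Matrix B B ℂ | σ.PosSemidef ∧ σ.trace.re ≤ κ}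
  set φ : Matrix B B ℂ → Matrix (A × B) (A × B) ℂ := fun σ => 1 ⊗ₖ σ - τ with hφ
  have hΩ : Convex ℝ Ω := by
    refine convex_posSemidef.inter fun M hM N hN a b ha hb hab => ?_
    change M.trace.re ≤ κ at hM
    change N.trace.re ≤ κ at hN
    change (a • M + b • N).trace.re ≤ κ
    rw [trace_add, Complex.add_re, re_trace_smul, re_trace_smul]
    have : κ = a * κ + b * κ := by rw [← add_mul, hab, one_mul]
    nlinarith
  have hconv : Convex ℝ (φ '' Ω) := by
    rintro _ ⟨s, hs, rfl⟩ _ ⟨t, ht, rfl⟩ a b ha hb hab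
    refine ⟨a • s + b • t, hΩ hs ht ha hb hab, ?_⟩
    have : τ = a • τ + b • τ := by rw [← add_smul, hab, one_smul]
    simp only [hφ, kronecker_add, kronecker_smul, smul_sub]
    nth_rewrite 1 [this]
    abel
  have hcomp : IsCompact (φ '' Ω) :=
    (isCompact_posSemidef_trace_le κ).image (continuous_one_kronecker.sub continuous_const)
  have hdisj : Disjoint (φ '' Ω) {M | M.PosSemidef} := by
    rw [Set.disjoint_left]
    rintro _ ⟨σ, hσ, rfl⟩ hP
    exact absurd hσ.2 (not_le.2 (hcon σ hσ.1 hP))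
  have : LocallyConvexSpace ℝ (Matrix (A × B) (A × B) ℂ) :=
    inferInstanceAs (LocallyConvexSpace ℝ ((A × B) → (A × B) → ℂ))
  obtain ⟨f, u, v, hu, huv, hv⟩ := geometric_hahn_banach_compact_closed hconv hcomp
    convex_posSemidef isClosed_posSemidef hdisj
  obtain ⟨H, hH, hfH⟩ := exists_hermitian_re_trace f.toLinearMap
  have hv0 : v < 0 := by simpa using hv 0 PosSemidef.zero
  have hHp : H.PosSemidef := by
    refine posSemidef_of_re_trace_mul_nonneg hH fun P hP => ?_
    rw [← hfH P hP.1]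
    change 0 ≤ f P
    by_contra hneg
    push Not at hneg
    -- Scaled so that `f` takes exactly the value `v`, which the separation forbids on the cone.
    have h1 := hv _ (hP.real_smul (c := v / f P) (div_nonneg_of_nonpos hv0.le hneg.le))
    rw [map_smul, smul_eq_mul, div_mul_cancel₀ _ (ne_of_lt hneg)] at h1
    exact lt_irrefl _ h1
  set t := (τ * H).trace.re with ht
  have hS : ∀ σ : Matrix B B ℂ, σ.PosSemidef → σ.trace.re ≤ κ →
      (σ * partialTrace H).trace.re ≤ t + u := by
    intro σ hσ hσκ
    have h1 := (hu _ ⟨σ, ⟨hσ, hσκ⟩, rfl⟩).le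
    have h2 : (φ σ).IsHermitian := (PosSemidef.one.kronecker hσ).1.sub hτ.1
    have h3 : f (φ σ) = (H * φ σ).trace.re := hfH _ h2
    rw [h3, hφ, trace_mul_comm, sub_mul, trace_sub, Complex.sub_re, trace_one_kronecker_mul] at h1
    linarith
  have hs0 : 0 ≤ t + u := by simpa using hS 0 PosSemidef.zero (by simpa using hκ.le)
  -- The separation bounds `Tr(σ Tr_A H)` by `t + u < t`, but `t + u` may be zero; `t / 2` keeps the
  -- normalising factor `κ / s` finite.
  set s := max (t + u) (t / 2) with hs
  have htpos : 0 < t := by linarith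
  have hspos : 0 < s := lt_of_lt_of_le (by linarith) (le_max_right _ _)
  have hst : s < t := max_lt (by linarith) (by linarith)
  have hpt : (partialTrace H).IsHermitian := partialTrace_isHermitian hH
  have hN : ((1 : Matrix B B ℂ) - partialTrace ((κ / s) • H)).PosSemidef := by
    refine posSemidef_of_re_trace_mul_nonneg ?_ fun P hP => ?_
    · rw [partialTrace_smul]
      refine isHermitian_one.sub ?_
      rw [IsHermitian, conjTranspose_smul, hpt.eq, star_trivial]
    · rw [sub_mul, one_mul, trace_sub, Complex.sub_re, partialTrace_smul, smul_mul_assoc,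
        re_trace_smul, trace_mul_comm]
      rcases hP.re_trace_nonneg.eq_or_lt with h0 | h0
      · have : P = 0 := by
          rw [← hP.trace_eq_zero_iff]
          have := Complex.le_def.1 hP.trace_nonneg
          exact Complex.ext h0.symm this.2.symm
        simp [this]
      · have h1 := hS ((κ / P.trace.re) • P) (hP.real_smul (by positivity))
          (by rw [re_trace_smul, div_mul_cancel₀ _ h0.ne'])
        rw [smul_mul_assoc, re_trace_smul] at h1
        have h2 := h1.trans (le_max_left _ (t / 2))
        rw [← hs, div_mul_eq_mul_div, div_le_iff₀ h0] at h2
        rw [sub_nonneg, div_mul_eq_mul_div, div_le_iff₀ hspos]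
        linarith
  have hfin := h _ (hHp.real_smul (c := κ / s) (by positivity)) hN
  rw [mul_smul_comm, re_trace_smul, ← ht, div_mul_eq_mul_div, div_le_iff₀ hspos] at hfin
  nlinarith

end duality

end PartialTrace

/-! ### Optimal certificates: a good smoothed state or a dual bound. -/

section Dichotomy

open Matrix Filter Topology

section inverse

variable {n : Type*} [Fintype n] [DecidableEq n]

theorem Matrix.PosDef.isUnit_det' {Y : Matrix n n ℂ} (hY : Y.PosDef) : IsUnit Y.det :=
  (isUnit_iff_isUnit_det _).1 hY.isUnit

theorem Matrix.PosDef.continuousAt_inv {Y : Matrix n n ℂ} (hY : Y.PosDef) :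
    ContinuousAt (fun X : Matrix n n ℂ => X⁻¹) Y := by
  simp only [inv_def, Ring.inverse_eq_inv']
  refine ContinuousAt.smul (ContinuousAt.inv₀ ?_ hY.isUnit_det'.ne_zero) ?_
  · exact continuous_id.matrix_det.continuousAt
  · exact continuous_id.matrix_adjugate.continuousAt

omit [Fintype n] in
theorem Matrix.PosSemidef.add_smul_one_posDef {M : Matrix n n ℂ} (hM : M.PosSemidef) {q : ℝ}
    (hq : 0 < q) : (M + q • (1 : Matrix n n ℂ)).PosDef :=
  PosDef.posSemidef_add hM (PosDef.one.smul hq)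

/-- First-order optimality for `Y ↦ Tr (ρ Y⁻¹)` along a segment. -/
theorem re_trace_le_of_isMin_inv {ρ Y Y' : Matrix n n ℂ} (hY : Y.PosDef) (hY' : Y'.PosDef)
    (h : ∀ t : ℝ, 0 < t → t ≤ 1 →
      (ρ * Y⁻¹).trace.re ≤ (ρ * ((1 - t) • Y + t • Y')⁻¹).trace.re) :
    (Y⁻¹ * ρ * Y⁻¹ * Y').trace.re ≤ (Y⁻¹ * ρ * Y⁻¹ * Y).trace.re := by
  set W : ℝ → Matrix n n ℂ := fun t => (1 - t) • Y + t • Y' with hW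
  have hWpos : ∀ t : ℝ, 0 < t → t < 1 → (W t).PosDef := fun t h0 h1 =>
    (hY.smul (by linarith)).add (hY'.smul h0)
  have hW0 : W 0 = Y := by simp [hW]
  have hWc : Continuous W := by fun_prop
  have hlim : Tendsto (fun t => (ρ * Y⁻¹ * (Y' - Y) * (W t)⁻¹).trace.re) (𝓝[>] 0)
      (𝓝 (ρ * Y⁻¹ * (Y' - Y) * Y⁻¹).trace.re) := by
    have h1 : ContinuousAt (fun t => (W t)⁻¹) 0 :=
      ContinuousAt.comp (f := W) (g := fun X => X⁻¹) (by rw [hW0]; exact hY.continuousAt_inv)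
        hWc.continuousAt
    have h2 : Continuous fun X : Matrix n n ℂ => (ρ * Y⁻¹ * (Y' - Y) * X).trace.re :=
      continuous_re_trace.comp (continuous_const.mul continuous_id)
    have h3 := (h2.continuousAt.comp h1).tendsto
    simp only [Function.comp_def, hW0] at h3
    exact h3.mono_left nhdsWithin_le_nhds
  have hle : (ρ * Y⁻¹ * (Y' - Y) * Y⁻¹).trace.re ≤ 0 := by
    refine le_of_tendsto hlim ?_
    filter_upwards [Ioo_mem_nhdsGT (zero_lt_one' ℝ)] with t ht
    have h1 := h t ht.1 ht.2.le
    -- Resolvent identity: it exhibits the difference quotient exactly, so only continuity of the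
    -- inverse is needed in the limit.
    have h2 : ρ * Y⁻¹ - ρ * (W t)⁻¹ = t • (ρ * Y⁻¹ * (Y' - Y) * (W t)⁻¹) := by
      have h3 : t • (Y' - Y) = W t - Y := by
        simp only [hW, sub_smul, smul_sub, one_smul]; abel
      rw [← smul_mul_assoc, ← mul_smul_comm, h3, mul_sub, sub_mul, mul_assoc,
        mul_nonsing_inv _ (hWpos t ht.1 ht.2).isUnit_det', mul_one, mul_assoc ρ,
        nonsing_inv_mul _ hY.isUnit_det', mul_one]
    have h4 := congrArg (fun X => X.trace.re) h2
    simp only [trace_sub, Complex.sub_re, re_trace_smul] at h4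
    change _ ≤ (ρ * (W t)⁻¹).trace.re at h1
    nlinarith [ht.1]
  rw [mul_sub, sub_mul, trace_sub, Complex.sub_re] at hle
  have e : ∀ X : Matrix n n ℂ, (Y⁻¹ * ρ * Y⁻¹ * X).trace = (ρ * Y⁻¹ * X * Y⁻¹).trace := by
    intro X
    rw [mul_assoc Y⁻¹, mul_assoc Y⁻¹, trace_mul_comm]
  rw [e, e]
  linarith

end inverse

variable {A B : Type*} [Fintype A] [Fintype B] [DecidableEq A] [DecidableEq B]

/-- Taking the trace of the constraint bounds `λ Tr M` by `(1 - q)` times the dimension of `B`. -/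
theorem isCompact_dual_feasible {lam η : ℝ} (hlam : 0 < lam) :
    IsCompact {p : Matrix (A × B) (A × B) ℂ × ℝ | p.1.PosSemidef ∧ η ≤ p.2 ∧ p.2 ≤ 1 ∧
      ((1 - p.2) • (1 : Matrix B B ℂ) - lam • partialTrace p.1).PosSemidef} := by
  refine IsCompact.of_isClosed_subset
    ((isCompact_posSemidef_trace_le (n := A × B) ((1 - η) * Fintype.card B / lam)).prod
      (isCompact_Icc (a := η) (b := 1))) ?_ ?_
  · refine (isClosed_posSemidef.preimage continuous_fst).inter
      ((isClosed_le continuous_const continuous_snd).inter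
      ((isClosed_le continuous_snd continuous_const).inter (isClosed_posSemidef.preimage
        (f := fun p : Matrix (A × B) (A × B) ℂ × ℝ =>
          (1 - p.2) • (1 : Matrix B B ℂ) - lam • partialTrace p.1) ?_)))
    exact ((continuous_const.sub continuous_snd).smul continuous_const).sub
      ((continuous_partialTrace.comp continuous_fst).const_smul lam)
  · rintro ⟨M, q⟩ ⟨hM, h1, h2, h3⟩
    refine ⟨⟨hM, ?_⟩, h1, h2⟩
    have h4 := h3.re_trace_nonneg
    rw [trace_sub, Complex.sub_re, re_trace_smul, re_trace_smul, trace_partialTrace,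
      trace_one] at h4
    simp only [Complex.natCast_re] at h4
    rw [le_div_iff₀ hlam]
    have : (1 - q) * (Fintype.card B : ℝ) ≤ (1 - η) * Fintype.card B :=
      mul_le_mul_of_nonneg_right (by simp only at h1; linarith) (Nat.cast_nonneg _)
    simp only at *
    linarith

/-- Either some `Z ρ Z` of large fidelity with `ρ` has large min-entropy, or there is a dual
certificate that no such operator exists. -/
theorem exists_feasible_or_dual {ρ : Matrix (A × B) (A × B) ℂ} (hρ : ρ.PosSemidef)
    {lam lam' c : ℝ} (hlam : 0 < lam) (hlam' : lam < lam') (hc : 0 < c) :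
    (∃ Z : Matrix (A × B) (A × B) ℂ, Z.PosSemidef ∧ c ≤ (ρ * Z).trace.re ^ 2 ∧
      (Z * ρ * Z).trace.re ≤ 1 ∧ ∃ σ : Matrix B B ℂ, σ.PosSemidef ∧
        ((1 : Matrix A A ℂ) ⊗ₖ σ - Z * ρ * Z).PosSemidef ∧ σ.trace.re ≤ lam') ∨
    (∃ (M : Matrix (A × B) (A × B) ℂ) (q : ℝ), M.PosSemidef ∧ 0 < q ∧ q ≤ 1 ∧
      ((1 - q) • (1 : Matrix B B ℂ) - lam • partialTrace M).PosSemidef ∧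
      (ρ * (M + q • 1)⁻¹).trace.re < c ∧
      ((M + q • 1)⁻¹ * ρ * (M + q • 1)⁻¹).trace.re ≤ (ρ * (M + q • 1)⁻¹).trace.re) := by
  have hl'pos : 0 < lam' := hlam.trans hlam'
  -- Requiring `q ≥ η > 0` keeps `M + q` invertible on a compact set. The price is exactly the
  -- passage from `lam` to `lam'`, since `1 - η = lam / lam'`.
  set η : ℝ := 1 - lam / lam' with hη
  have hη0 : 0 < η := by rw [hη, sub_pos, div_lt_one hl'pos]; exact hlam'
  have hη1 : η ≤ 1 := by rw [hη]; linarith [div_pos hlam hl'pos]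
  set D := {p : Matrix (A × B) (A × B) ℂ × ℝ | p.1.PosSemidef ∧ η ≤ p.2 ∧ p.2 ≤ 1 ∧
      ((1 - p.2) • (1 : Matrix B B ℂ) - lam • partialTrace p.1).PosSemidef} with hD
  have hDone : ((0, 1) : Matrix (A × B) (A × B) ℂ × ℝ) ∈ D :=
    ⟨PosSemidef.zero, hη1, le_rfl, by simp [partialTrace_zero, PosSemidef.zero]⟩
  have hpos : ∀ p ∈ D, (p.1 + p.2 • (1 : Matrix (A × B) (A × B) ℂ)).PosDef := fun p hp =>
    hp.1.add_smul_one_posDef (hη0.trans_le hp.2.1)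
  have hcont : ContinuousOn (fun p : Matrix (A × B) (A × B) ℂ × ℝ =>
      (ρ * (p.1 + p.2 • (1 : Matrix (A × B) (A × B) ℂ))⁻¹).trace.re) D := by
    intro p hp
    have h1 : ContinuousAt (fun p : Matrix (A × B) (A × B) ℂ × ℝ =>
        (p.1 + p.2 • (1 : Matrix (A × B) (A × B) ℂ))⁻¹) p :=
      ContinuousAt.comp (f := fun p : Matrix (A × B) (A × B) ℂ × ℝ =>
        p.1 + p.2 • (1 : Matrix (A × B) (A × B) ℂ)) (g := fun X => X⁻¹)
        (hpos p hp).continuousAt_inv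
        (continuous_fst.add (continuous_snd.smul continuous_const)).continuousAt
    have h2 : Continuous fun X : Matrix (A × B) (A × B) ℂ => (ρ * X).trace.re :=
      continuous_re_trace.comp (continuous_const.mul continuous_id)
    exact (h2.continuousAt.comp h1).continuousWithinAt
  obtain ⟨⟨M, q⟩, hMq, hmin⟩ := (isCompact_dual_feasible hlam).exists_isMinOn ⟨_, hDone⟩ hcont
  have hMq' := hMq
  obtain ⟨hM, hqη, hq1, hN⟩ := hMq'
  simp only at hM hqη hq1 hN
  have hYpos := hpos _ hMq
  simp only at hYpos
  have hopt : ∀ p ∈ D, ((M + q • 1)⁻¹ * ρ * (M + q • 1)⁻¹ * (p.1 + p.2 • 1)).trace.re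
      ≤ ((M + q • 1)⁻¹ * ρ * (M + q • 1)⁻¹ * (M + q • 1)).trace.re := by
    rintro ⟨M', q'⟩ hp
    refine re_trace_le_of_isMin_inv hYpos (hpos _ hp) fun t ht0 ht1 => ?_
    have hmem : ((1 - t) • M + t • M', (1 - t) * q + t * q') ∈ D := by
      obtain ⟨g1, g2, g3, g4⟩ := hp
      simp only at g1 g2 g3 g4
      have ht1' : 0 ≤ 1 - t := by linarith
      refine ⟨(hM.real_smul ht1').add (g1.real_smul ht0.le), ?_, ?_, ?_⟩
      · simp only; nlinarith
      · simp only; nlinarith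
      · have := (hN.real_smul ht1').add (g4.real_smul ht0.le)
        convert! this using 1
        simp only [partialTrace_add, partialTrace_smul]
        module
    have h1 := hmin hmem
    simp only [Set.mem_ofPred_eq] at h1
    convert! h1 using 5
    module
  set Y := M + q • (1 : Matrix (A × B) (A × B) ℂ) with hY
  have hYi := hYpos.inv.posSemidef
  set f := (ρ * Y⁻¹).trace.re with hf
  have hτp : (Y⁻¹ * ρ * Y⁻¹).PosSemidef := by
    simpa [hYi.1.eq] using hρ.conjTranspose_mul_mul_same Y⁻¹
  have hτY : (Y⁻¹ * ρ * Y⁻¹ * Y).trace.re = f := by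
    rw [mul_assoc, nonsing_inv_mul _ hYpos.isUnit_det', mul_one, trace_mul_comm]
  -- Optimality tested against the feasible point `Y' = 1`. Besides the trace bound, this inequality
  -- is what the joint estimate needs.
  have hb : (Y⁻¹ * ρ * Y⁻¹).trace.re ≤ f := by
    simpa [hτY] using hopt _ hDone
  by_cases hfc : f < c
  · exact Or.inr ⟨M, q, hM, hη0.trans_le hqη, hq1, hN, hfc, hb⟩
  left
  push Not at hfc
  have hf0 : 0 < f := hc.trans_le hfc
  have hdual : ∀ M' : Matrix (A × B) (A × B) ℂ, M'.PosSemidef →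
      (1 - partialTrace M').PosSemidef → (Y⁻¹ * ρ * Y⁻¹ * M').trace.re ≤ f * lam' := by
    intro M' hM' hM1
    have hmem : ((lam'⁻¹ • M', η) : Matrix (A × B) (A × B) ℂ × ℝ) ∈ D := by
      refine ⟨hM'.real_smul (by positivity), le_rfl, hη1, ?_⟩
      have := hM1.real_smul (c := lam / lam') (by positivity)
      convert! this using 1
      simp only [partialTrace_smul, hη]
      module
    have h1 := hopt _ hmem
    rw [hτY, mul_add, trace_add, Complex.add_re, mul_smul_comm, mul_smul_comm, re_trace_smul,
      re_trace_smul, mul_one] at h1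
    have h2 : 0 ≤ η * (Y⁻¹ * ρ * Y⁻¹).trace.re := mul_nonneg hη0.le hτp.re_trace_nonneg
    have h3 : lam'⁻¹ * (Y⁻¹ * ρ * Y⁻¹ * M').trace.re ≤ f := by linarith
    rwa [inv_mul_le_iff₀ hl'pos, mul_comm] at h3
  obtain ⟨σ, hσ, hσd, hσt⟩ := exists_dominating_of_dual hτp (mul_pos hf0 hl'pos) hdual
  have hs : 0 < √f := Real.sqrt_pos.2 hf0
  have hss : (√f)⁻¹ * (√f)⁻¹ = f⁻¹ := by rw [← mul_inv, Real.mul_self_sqrt hf0.le]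
  -- With `Z = Y⁻¹ / √f` one has `Tr(ρ Z)² = f`, and the bounds on `Y⁻¹ ρ Y⁻¹` are divided by `f`.
  have hZ : ((√f)⁻¹ • Y⁻¹) * ρ * ((√f)⁻¹ • Y⁻¹) = f⁻¹ • (Y⁻¹ * ρ * Y⁻¹) := by
    rw [smul_mul_assoc, smul_mul_assoc, mul_smul_comm, smul_smul, hss]
  refine ⟨(√f)⁻¹ • Y⁻¹, hYi.real_smul (by positivity), ?_, ?_, f⁻¹ • σ,
    hσ.real_smul (by positivity), ?_, ?_⟩
  · rw [mul_smul_comm, re_trace_smul, ← hf, mul_pow, sq, hss]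
    have : f⁻¹ * f ^ 2 = f := by field_simp
    rw [this]; exact hfc
  · rw [hZ, re_trace_smul, inv_mul_le_iff₀ hf0, mul_one]; exact hb
  · rw [hZ, kronecker_smul, ← smul_sub]
    exact hσd.real_smul (by positivity)
  · rw [re_trace_smul, inv_mul_le_iff₀ hf0]; exact hσt

end Dichotomy

/-! ### The product of two certificates. -/

section Joint

open Matrix

theorem partialTrace_posSemidef {A B : Type*} [Fintype A] [DecidableEq A] [Fintype B]
    [DecidableEq B] {M : Matrix (A × B) (A × B) ℂ} (hM : M.PosSemidef) :
    (partialTrace M).PosSemidef := by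
  refine posSemidef_of_re_trace_mul_nonneg (partialTrace_isHermitian hM.1) fun P hP => ?_
  rw [trace_mul_comm, ← trace_one_kronecker_mul]
  exact (PosSemidef.one.kronecker hP).re_trace_mul_nonneg hM

theorem Matrix.IsHermitian.im_trace_mul {n : Type*} [Fintype n] {X Y : Matrix n n ℂ}
    (hX : X.IsHermitian) (hY : Y.IsHermitian) : (X * Y).trace.im = 0 := by
  have h : star (X * Y).trace = (X * Y).trace := by
    rw [← trace_conjTranspose, conjTranspose_mul, hX.eq, hY.eq, trace_mul_comm]
  exact Complex.conj_eq_iff_im.1 h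

/-- Here `a = Tr(ρ y)` and `b = Tr(ρ y²)`. Since `q = q₀ + q₁ - q₀ q₁` dominates both `qᵢ`, the
terms over `q` become linear in `q₀, q₁`. Then `aᵢ - bᵢ ≤ 1 - aᵢ` and `qᵢ ≤ 1` reduce the total to
`a₀ a₁ + a₀ (1 - a₁) + a₁ (1 - a₀)`. -/
theorem joint_value_le {a₀ a₁ b₀ b₁ q₀ q₁ : ℝ} (hb₀ : 0 ≤ b₀) (hb₁ : 0 ≤ b₁) (hab₀ : b₀ ≤ a₀)
    (hab₁ : b₁ ≤ a₁) (h₀ : 0 ≤ 1 - 2 * a₀ + b₀) (h₁ : 0 ≤ 1 - 2 * a₁ + b₁) (hq₀ : 0 < q₀)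
    (hq₁ : 0 < q₁) (hq₀' : q₀ ≤ 1) (hq₁' : q₁ ≤ 1) :
    a₀ * a₁ + q₀ * (b₀ * (a₁ - b₁)) + q₁ * (b₁ * (a₀ - b₀)) +
      (q₀ + q₁ - q₀ * q₁)⁻¹ * (q₀ ^ 2 * (b₀ * (1 - 2 * a₁ + b₁)) +
        q₁ ^ 2 * (b₁ * (1 - 2 * a₀ + b₀)) + 2 * (q₀ * q₁) * ((a₀ - b₀) * (a₁ - b₁)))
      ≤ 1 - (1 - a₀) * (1 - a₁) := by
  have hle₀ : q₀ ≤ q₀ + q₁ - q₀ * q₁ := by nlinarith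
  have hle₁ : q₁ ≤ q₀ + q₁ - q₀ * q₁ := by nlinarith
  set q := q₀ + q₁ - q₀ * q₁
  have hq : 0 < q := hq₀.trans_le hle₀
  have e₀ : 0 ≤ a₀ - b₀ := by linarith
  have e₁ : 0 ≤ a₁ - b₁ := by linarith
  have hu₀ : 0 ≤ b₀ * (1 - 2 * a₁ + b₁) := mul_nonneg hb₀ h₁
  have hu₁ : 0 ≤ b₁ * (1 - 2 * a₀ + b₀) := mul_nonneg hb₁ h₀
  have hw : 0 ≤ (a₀ - b₀) * (a₁ - b₁) := mul_nonneg e₀ e₁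
  have key : q⁻¹ * (q₀ ^ 2 * (b₀ * (1 - 2 * a₁ + b₁)) + q₁ ^ 2 * (b₁ * (1 - 2 * a₀ + b₀)) +
      2 * (q₀ * q₁) * ((a₀ - b₀) * (a₁ - b₁)))
      ≤ q₀ * (b₀ * (1 - 2 * a₁ + b₁)) + q₁ * (b₁ * (1 - 2 * a₀ + b₀)) +
        (q₀ + q₁) * ((a₀ - b₀) * (a₁ - b₁)) := by
    rw [inv_mul_le_iff₀ hq]
    have t₀ : q₀ ^ 2 ≤ q * q₀ := by nlinarith
    have t₁ : q₁ ^ 2 ≤ q * q₁ := by nlinarith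
    have t₂ : 2 * (q₀ * q₁) ≤ q * (q₀ + q₁) := by nlinarith
    linarith [mul_le_mul_of_nonneg_right t₀ hu₀, mul_le_mul_of_nonneg_right t₁ hu₁,
      mul_le_mul_of_nonneg_right t₂ hw]
  have ha₀ : a₀ ≤ 1 := by linarith
  have ha₁ : a₁ ≤ 1 := by linarith
  have r₀ : q₀ * (b₀ * (1 - a₁) + (a₀ - b₀) * (a₁ - b₁)) ≤ a₀ * (1 - a₁) := by
    have : b₀ * (1 - a₁) + (a₀ - b₀) * (a₁ - b₁) ≤ a₀ * (1 - a₁) := by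
      linarith [mul_nonneg e₀ h₁]
    have h0 : 0 ≤ a₀ * (1 - a₁) := mul_nonneg (by linarith) (by linarith)
    nlinarith
  have r₁ : q₁ * (b₁ * (1 - a₀) + (a₀ - b₀) * (a₁ - b₁)) ≤ a₁ * (1 - a₀) := by
    have : b₁ * (1 - a₀) + (a₀ - b₀) * (a₁ - b₁) ≤ a₁ * (1 - a₀) := by
      linarith [mul_nonneg e₁ h₀]
    have h0 : 0 ≤ a₁ * (1 - a₀) := mul_nonneg (by linarith) (by linarith)
    nlinarith
  linarith

section joint

variable {C D : Type*} [Fintype C] [DecidableEq C] [Fintype D] [DecidableEq D]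

omit [Fintype C] [DecidableEq C] [Fintype D] [DecidableEq D] in
theorem sub_kronecker_sub (X₀ Y₀ : Matrix C C ℂ) (X₁ Y₁ : Matrix D D ℂ) :
    (X₀ - Y₀) ⊗ₖ (X₁ - Y₁) = X₀ ⊗ₖ X₁ - X₀ ⊗ₖ Y₁ - Y₀ ⊗ₖ X₁ + Y₀ ⊗ₖ Y₁ := by
  ext ⟨i, k⟩ ⟨j, l⟩
  simp only [kronecker_apply, Matrix.sub_apply, Matrix.add_apply]
  ring

omit [DecidableEq C] [DecidableEq D] in
theorem re_trace_kronecker_mul_kronecker {ρ₀ X₀ : Matrix C C ℂ} {ρ₁ X₁ : Matrix D D ℂ}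
    (hρ₀ : ρ₀.IsHermitian) (hX₀ : X₀.IsHermitian) :
    ((ρ₀ ⊗ₖ ρ₁) * (X₀ ⊗ₖ X₁)).trace.re = (ρ₀ * X₀).trace.re * (ρ₁ * X₁).trace.re := by
  rw [← mul_kronecker_mul, trace_kronecker, Complex.mul_re, hρ₀.im_trace_mul hX₀]
  ring

/-- The difference is `q⁻¹ K⁻¹ P`, and `K⁻¹ P = K⁻¹ (P K) K⁻¹` with `P K = P² + q P ≥ 0`. -/
theorem inv_le_inv_smul_one {P : Matrix C C ℂ} (hP : P.PosSemidef) {q : ℝ} (hq : 0 < q) :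
    (q⁻¹ • (1 : Matrix C C ℂ) - (P + q • 1)⁻¹).PosSemidef := by
  have hK := hP.add_smul_one_posDef hq
  set K := P + q • (1 : Matrix C C ℂ) with hKdef
  have h1 : ((K⁻¹)ᴴ * (q • P + Pᴴ * P) * K⁻¹).PosSemidef :=
    ((hP.real_smul hq.le).add (posSemidef_conjTranspose_mul_self P)).conjTranspose_mul_mul_same _
  have h2 : q • P + Pᴴ * P = P * K := by
    rw [hP.1.eq, hKdef, mul_add, mul_smul_comm, mul_one, add_comm]
  rw [hK.inv.1.eq, h2, mul_assoc, mul_assoc, mul_nonsing_inv _ hK.isUnit_det', mul_one] at h1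
  have h3 : q⁻¹ • (1 : Matrix C C ℂ) - K⁻¹ = q⁻¹ • (K⁻¹ * P) := by
    have : P = K - q • 1 := by rw [hKdef]; abel
    rw [this, mul_sub, nonsing_inv_mul _ hK.isUnit_det', mul_smul_comm, mul_one, smul_sub,
      smul_smul, inv_mul_cancel₀ hq.ne', one_smul]
  rw [h3]
  exact h1.real_smul (inv_nonneg.2 hq.le)

/-- The dual certificates of two independent systems combine. -/
theorem re_trace_mul_inv_joint_le {ρ₀ M₀ : Matrix C C ℂ} {ρ₁ M₁ : Matrix D D ℂ}
    (hρ₀ : IsState ρ₀) (hρ₁ : IsState ρ₁) (hM₀ : M₀.PosSemidef) (hM₁ : M₁.PosSemidef)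
    {q₀ q₁ : ℝ} (hq₀ : 0 < q₀) (hq₁ : 0 < q₁) (hq₀' : q₀ ≤ 1) (hq₁' : q₁ ≤ 1)
    (hb₀ : ((M₀ + q₀ • 1)⁻¹ * ρ₀ * (M₀ + q₀ • 1)⁻¹).trace.re ≤
      (ρ₀ * (M₀ + q₀ • 1)⁻¹).trace.re)
    (hb₁ : ((M₁ + q₁ • 1)⁻¹ * ρ₁ * (M₁ + q₁ • 1)⁻¹).trace.re ≤
      (ρ₁ * (M₁ + q₁ • 1)⁻¹).trace.re) :
    ((ρ₀ ⊗ₖ ρ₁) * (M₀ ⊗ₖ M₁ + (q₀ + q₁ - q₀ * q₁) • 1)⁻¹).trace.re ≤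
      1 - (1 - (ρ₀ * (M₀ + q₀ • 1)⁻¹).trace.re) * (1 - (ρ₁ * (M₁ + q₁ • 1)⁻¹).trace.re) := by
  have hY₀ := hM₀.add_smul_one_posDef hq₀
  have hY₁ := hM₁.add_smul_one_posDef hq₁
  have hMy₀ : M₀ * (M₀ + q₀ • 1)⁻¹ = 1 - q₀ • (M₀ + q₀ • 1)⁻¹ := by
    have := mul_nonsing_inv _ hY₀.isUnit_det'
    rw [add_mul, smul_mul_assoc, one_mul] at this
    exact eq_sub_of_add_eq this
  have hMy₁ : M₁ * (M₁ + q₁ • 1)⁻¹ = 1 - q₁ • (M₁ + q₁ • 1)⁻¹ := by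
    have := mul_nonsing_inv _ hY₁.isUnit_det'
    rw [add_mul, smul_mul_assoc, one_mul] at this
    exact eq_sub_of_add_eq this
  have hy₀ := hY₀.inv
  have hy₁ := hY₁.inv
  set y₀ := (M₀ + q₀ • (1 : Matrix C C ℂ))⁻¹
  set y₁ := (M₁ + q₁ • (1 : Matrix D D ℂ))⁻¹
  set a₀ := (ρ₀ * y₀).trace.re with ha₀
  set a₁ := (ρ₁ * y₁).trace.re with ha₁
  have eb₀ : (y₀ * ρ₀ * y₀).trace.re = (ρ₀ * (y₀ * y₀)).trace.re := by
    rw [trace_mul_cycle, trace_mul_comm]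
  have eb₁ : (y₁ * ρ₁ * y₁).trace.re = (ρ₁ * (y₁ * y₁)).trace.re := by
    rw [trace_mul_cycle, trace_mul_comm]
  rw [eb₀] at hb₀
  rw [eb₁] at hb₁
  have hyy₀ : (y₀ * y₀).PosSemidef := by
    simpa [hy₀.1.eq] using posSemidef_conjTranspose_mul_self y₀
  have hyy₁ : (y₁ * y₁).PosSemidef := by
    simpa [hy₁.1.eq] using posSemidef_conjTranspose_mul_self y₁
  have hbn₀ := hρ₀.1.re_trace_mul_nonneg hyy₀
  have hbn₁ := hρ₁.1.re_trace_mul_nonneg hyy₁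
  have hv₀ : 0 ≤ 1 - 2 * a₀ + (ρ₀ * (y₀ * y₀)).trace.re := by
    have := hρ₀.1.re_trace_mul_nonneg (posSemidef_conjTranspose_mul_self (1 - y₀))
    simp only [conjTranspose_sub, conjTranspose_one, hy₀.1.eq, mul_sub, sub_mul, mul_one, one_mul,
      trace_sub, Complex.sub_re, hρ₀.2, Complex.one_re, ← ha₀] at this
    linarith
  have hv₁ : 0 ≤ 1 - 2 * a₁ + (ρ₁ * (y₁ * y₁)).trace.re := by
    have := hρ₁.1.re_trace_mul_nonneg (posSemidef_conjTranspose_mul_self (1 - y₁))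
    simp only [conjTranspose_sub, conjTranspose_one, hy₁.1.eq, mul_sub, sub_mul, mul_one, one_mul,
      trace_sub, Complex.sub_re, hρ₁.2, Complex.one_re, ← ha₁] at this
    linarith
  refine le_trans ?_ (joint_value_le hbn₀ hbn₁ hb₀ hb₁ hv₀ hv₁ hq₀ hq₁ hq₀' hq₁')
  set b₀ := (ρ₀ * (y₀ * y₀)).trace.re with hb₀def
  set b₁ := (ρ₁ * (y₁ * y₁)).trace.re with hb₁def
  set q := q₀ + q₁ - q₀ * q₁ with hqdef
  have hq : 0 < q := by nlinarith
  have hP := hM₀.kronecker hM₁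
  have hK := hP.add_smul_one_posDef hq
  have hinv := inv_le_inv_smul_one hP hq
  set K := M₀ ⊗ₖ M₁ + q • (1 : Matrix (C × D) (C × D) ℂ) with hKdef
  set W := y₀ ⊗ₖ y₁ with hW
  have hWh : Wᴴ = W := (hy₀.kronecker hy₁).1
  -- `W = y₀ ⊗ y₁` serves as an approximate inverse of `K`, with defect `δ = 1 - K W`.
  set δ := q₀ • (y₀ ⊗ₖ (1 : Matrix D D ℂ)) + q₁ • ((1 : Matrix C C ℂ) ⊗ₖ y₁)
    - (q₀ + q₁) • (y₀ ⊗ₖ y₁) with hδ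
  have hδh : δᴴ = δ := by
    simp only [hδ, conjTranspose_sub, conjTranspose_add, conjTranspose_smul,
      conjTranspose_kronecker, hy₀.1.eq, hy₁.1.eq, conjTranspose_one, star_trivial]
  clear_value δ
  have hKW : K * W = 1 - δ := by
    rw [hKdef, hW, add_mul, ← mul_kronecker_mul, hMy₀, hMy₁, smul_mul_assoc, one_mul, hδ, hqdef]
    simp only [sub_kronecker_sub, kronecker_smul, smul_kronecker, one_kronecker_one]
    module
  have hWK : W * K = 1 - δ := by
    have := congrArg conjTranspose hKW
    rwa [conjTranspose_mul, hK.1.eq, hWh, conjTranspose_sub, conjTranspose_one, hδh] at this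
  -- An exact second-order expansion; its remainder is sandwiched by `δ`, so the crude bound `K⁻¹ ≤
  -- q⁻¹` suffices there.
  have hKinv : K⁻¹ = W + W * δ + δ * K⁻¹ * δ := by
    have h1 : δ = 1 - K * W := by rw [hKW]; abel
    have h2 : δ = 1 - W * K := by rw [hWK]; abel
    have h3 : δ * K⁻¹ = K⁻¹ - W := by
      rw [h2, sub_mul, one_mul, mul_assoc, mul_nonsing_inv _ hK.isUnit_det', mul_one]
    have h4 : K⁻¹ * δ = K⁻¹ - W := by
      rw [h1, mul_sub, mul_one, ← mul_assoc, nonsing_inv_mul _ hK.isUnit_det', one_mul]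
    rw [h3, sub_mul, h4]
    abel
  have hrem : 0 ≤ ((ρ₀ ⊗ₖ ρ₁) * (q⁻¹ • (δ * δ) - δ * K⁻¹ * δ)).trace.re := by
    have h1 := hinv.conjTranspose_mul_mul_same δ
    rw [hδh, mul_sub, sub_mul, mul_smul_comm, mul_one, smul_mul_assoc] at h1
    exact (hρ₀.1.kronecker hρ₁.1).re_trace_mul_nonneg h1
  have E : ∀ {X₀ : Matrix C C ℂ} {X₁ : Matrix D D ℂ}, X₀.IsHermitian →
      ((ρ₀ ⊗ₖ ρ₁) * (X₀ ⊗ₖ X₁)).trace.re = (ρ₀ * X₀).trace.re * (ρ₁ * X₁).trace.re :=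
    fun hX => re_trace_kronecker_mul_kronecker hρ₀.1.1 hX
  have hWδ : ((ρ₀ ⊗ₖ ρ₁) * (W * δ)).trace.re = q₀ * (b₀ * a₁) + q₁ * (a₀ * b₁)
      - (q₀ + q₁) * (b₀ * b₁) := by
    have h1 : W * δ = q₀ • ((y₀ * y₀) ⊗ₖ y₁) + q₁ • (y₀ ⊗ₖ (y₁ * y₁))
        - (q₀ + q₁) • ((y₀ * y₀) ⊗ₖ (y₁ * y₁)) := by
      rw [hδ, hW]
      simp only [mul_add, mul_sub, mul_smul_comm, ← mul_kronecker_mul, mul_one]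
    rw [h1]
    simp only [mul_add, mul_sub, mul_smul_comm, trace_add, trace_sub, Complex.add_re,
      Complex.sub_re, re_trace_smul, E hyy₀.1, E hy₀.1]
    rfl
  have hδδ : ((ρ₀ ⊗ₖ ρ₁) * (δ * δ)).trace.re = q₀ ^ 2 * b₀ + q₁ ^ 2 * b₁
      + (q₀ + q₁) ^ 2 * (b₀ * b₁) + 2 * (q₀ * q₁) * (a₀ * a₁)
      - 2 * (q₀ * (q₀ + q₁)) * (b₀ * a₁) - 2 * (q₁ * (q₀ + q₁)) * (a₀ * b₁) := by
    have h1 : δ * δ = q₀ ^ 2 • ((y₀ * y₀) ⊗ₖ (1 : Matrix D D ℂ))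
        + q₁ ^ 2 • ((1 : Matrix C C ℂ) ⊗ₖ (y₁ * y₁))
        + (q₀ + q₁) ^ 2 • ((y₀ * y₀) ⊗ₖ (y₁ * y₁)) + (2 * (q₀ * q₁)) • (y₀ ⊗ₖ y₁)
        - (2 * (q₀ * (q₀ + q₁))) • ((y₀ * y₀) ⊗ₖ y₁)
        - (2 * (q₁ * (q₀ + q₁))) • (y₀ ⊗ₖ (y₁ * y₁)) := by
      rw [hδ]
      simp only [mul_add, mul_sub, add_mul, sub_mul, mul_smul_comm, smul_mul_assoc,
        ← mul_kronecker_mul, mul_one, one_mul]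
      module
    rw [h1]
    simp only [mul_add, mul_sub, mul_smul_comm, trace_add, trace_sub, Complex.add_re,
      Complex.sub_re, re_trace_smul, E hyy₀.1, E hy₀.1, E isHermitian_one, mul_one, hρ₀.2, hρ₁.2,
      Complex.one_re, one_mul]
    rfl
  rw [hKinv]
  rw [mul_sub, trace_sub, Complex.sub_re, mul_smul_comm, re_trace_smul, hδδ] at hrem
  rw [mul_add, mul_add, trace_add, trace_add, Complex.add_re, Complex.add_re, hWδ, hW, E hy₀.1]
  rw [← ha₀, ← ha₁]
  have hfin : q₀ ^ 2 * b₀ + q₁ ^ 2 * b₁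
      + (q₀ + q₁) ^ 2 * (b₀ * b₁) + 2 * (q₀ * q₁) * (a₀ * a₁)
      - 2 * (q₀ * (q₀ + q₁)) * (b₀ * a₁) - 2 * (q₁ * (q₀ + q₁)) * (a₀ * b₁)
      = q₀ ^ 2 * (b₀ * (1 - 2 * a₁ + b₁)) +
        q₁ ^ 2 * (b₁ * (1 - 2 * a₀ + b₀)) + 2 * (q₀ * q₁) * ((a₀ - b₀) * (a₁ - b₁)) := by ring
  rw [hfin] at hrem
  linarith

end joint

end Joint

/-! ### Independent systems, cq-states and min-entropy. -/

section CQ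

open Matrix

theorem trace_submatrix_equiv {m n : Type*} [Fintype m] [Fintype n] (X : Matrix n n ℂ)
    (e : m ≃ n) : (X.submatrix e e).trace = X.trace :=
  Equiv.sum_comp e fun i => X i i

section indep

variable {A₀ A₁ B₀ B₁ : Type*} [Fintype A₀] [DecidableEq A₀] [Fintype A₁] [DecidableEq A₁]
  [Fintype B₀] [DecidableEq B₀] [Fintype B₁] [DecidableEq B₁]

omit [DecidableEq A₀] [DecidableEq A₁] [DecidableEq B₀] [DecidableEq B₁] in
theorem indepState_posSemidef {ρ₀ : Matrix (A₀ × B₀) (A₀ × B₀) ℂ}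
    {ρ₁ : Matrix (A₁ × B₁) (A₁ × B₁) ℂ} (h₀ : ρ₀.PosSemidef) (h₁ : ρ₁.PosSemidef) :
    (indepState ρ₀ ρ₁).PosSemidef :=
  (h₀.kronecker h₁).submatrix _

omit [DecidableEq A₀] [DecidableEq A₁] [Fintype B₀] [DecidableEq B₀] [Fintype B₁]
  [DecidableEq B₁] in
theorem partialTrace_indepState (M₀ : Matrix (A₀ × B₀) (A₀ × B₀) ℂ)
    (M₁ : Matrix (A₁ × B₁) (A₁ × B₁) ℂ) :
    partialTrace (indepState M₀ M₁) = partialTrace M₀ ⊗ₖ partialTrace M₁ := by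
  ext ⟨b₀, b₁⟩ ⟨c₀, c₁⟩
  simp only [partialTrace_apply, kronecker_apply, Fintype.sum_prod_type, Finset.sum_mul_sum]
  rfl

theorem re_trace_indepState_mul_inv (ρ₀ M₀ : Matrix (A₀ × B₀) (A₀ × B₀) ℂ)
    (ρ₁ M₁ : Matrix (A₁ × B₁) (A₁ × B₁) ℂ) (q : ℝ) :
    (indepState ρ₀ ρ₁ * (indepState M₀ M₁ + q • 1)⁻¹).trace.re =
      ((ρ₀ ⊗ₖ ρ₁) * (M₀ ⊗ₖ M₁ + q • 1)⁻¹).trace.re := by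
  have h1 : indepState M₀ M₁ + q • 1 =
      (M₀ ⊗ₖ M₁ + q • 1).submatrix (Equiv.prodProdProdComm A₀ B₀ A₁ B₁).symm
        (Equiv.prodProdProdComm A₀ B₀ A₁ B₁).symm := by
    rw [submatrix_add, submatrix_smul]
    simp only [Pi.add_apply, Pi.smul_apply, submatrix_one_equiv]
    rfl
  have h2 : indepState ρ₀ ρ₁ = (ρ₀ ⊗ₖ ρ₁).submatrix (Equiv.prodProdProdComm A₀ B₀ A₁ B₁).symm
        (Equiv.prodProdProdComm A₀ B₀ A₁ B₁).symm := rfl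
  rw [h1, inv_submatrix_equiv, h2, submatrix_mul_equiv, trace_submatrix_equiv]

theorem kronecker_le_smul_one {N₀ : Matrix B₀ B₀ ℂ} {N₁ : Matrix B₁ B₁ ℂ} (h₀ : N₀.PosSemidef)
    {p₀ p₁ lam : ℝ} (hlam : 0 < lam) (hp₁ : 0 ≤ p₁)
    (hN₀ : (p₀ • 1 - lam • N₀).PosSemidef) (hN₁ : (p₁ • 1 - lam • N₁).PosSemidef) :
    ((p₀ * p₁) • (1 : Matrix (B₀ × B₁) (B₀ × B₁) ℂ) - lam ^ 2 • (N₀ ⊗ₖ N₁)).PosSemidef := by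
  -- `p₀ p₁ - λ² N₀ ⊗ N₁ = (p₀ - λ N₀) ⊗ p₁ + λ N₀ ⊗ (p₁ - λ N₁)`.
  have h := (hN₀.kronecker
    (PosSemidef.one.real_smul hp₁ : (p₁ • (1 : Matrix B₁ B₁ ℂ)).PosSemidef)).add
    ((h₀.real_smul hlam.le).kronecker hN₁)
  convert! h using 1
  rw [← one_kronecker_one]
  ext ⟨i, k⟩ ⟨j, l⟩
  simp only [kronecker_apply, Matrix.sub_apply, Matrix.add_apply, Matrix.smul_apply,
    Complex.real_smul]
  push_cast
  ring

/-- Dual certificates for two independent systems bound the fidelity of their joint state with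
every operator of large min-entropy. -/
theorem fidelity_sq_indepState_le {ρ₀ M₀ : Matrix (A₀ × B₀) (A₀ × B₀) ℂ}
    {ρ₁ M₁ : Matrix (A₁ × B₁) (A₁ × B₁) ℂ}
    (hρ₀ : IsState ρ₀) (hρ₁ : IsState ρ₁) (hM₀ : M₀.PosSemidef) (hM₁ : M₁.PosSemidef)
    {q₀ q₁ lam : ℝ} (hlam : 0 < lam) (hq₀ : 0 < q₀) (hq₁ : 0 < q₁) (hq₀' : q₀ ≤ 1) (hq₁' : q₁ ≤ 1)
    (hN₀ : ((1 - q₀) • (1 : Matrix B₀ B₀ ℂ) - lam • partialTrace M₀).PosSemidef)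
    (hN₁ : ((1 - q₁) • (1 : Matrix B₁ B₁ ℂ) - lam • partialTrace M₁).PosSemidef)
    (hb₀ : ((M₀ + q₀ • 1)⁻¹ * ρ₀ * (M₀ + q₀ • 1)⁻¹).trace.re ≤
      (ρ₀ * (M₀ + q₀ • 1)⁻¹).trace.re)
    (hb₁ : ((M₁ + q₁ • 1)⁻¹ * ρ₁ * (M₁ + q₁ • 1)⁻¹).trace.re ≤
      (ρ₁ * (M₁ + q₁ • 1)⁻¹).trace.re)
    {τ : Matrix ((A₀ × A₁) × (B₀ × B₁)) ((A₀ × A₁) × (B₀ × B₁)) ℂ} (hτ : τ.PosSemidef)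
    (hτ1 : τ.trace.re ≤ 1) {σ : Matrix (B₀ × B₁) (B₀ × B₁) ℂ} (hσ : σ.PosSemidef)
    (hτσ : ((1 : Matrix (A₀ × A₁) (A₀ × A₁) ℂ) ⊗ₖ σ - τ).PosSemidef)
    (hσt : σ.trace.re ≤ lam ^ 2) :
    fidelity (indepState ρ₀ ρ₁) τ ^ 2 ≤
      1 - (1 - (ρ₀ * (M₀ + q₀ • 1)⁻¹).trace.re) * (1 - (ρ₁ * (M₁ + q₁ • 1)⁻¹).trace.re) := by
  -- Chosen so that `1 - q = (1 - q₀)(1 - q₁)`, the constant with which the two constraints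
  -- multiply.
  set q := q₀ + q₁ - q₀ * q₁ with hqdef
  have hq : 0 < q := by nlinarith
  have hM := indepState_posSemidef hM₀ hM₁
  have hK := hM.add_smul_one_posDef hq
  have h1 := fidelity_sq_le (indepState_posSemidef hρ₀.1 hρ₁.1) hτ hK
  rw [re_trace_indepState_mul_inv] at h1
  have h2 := re_trace_mul_inv_joint_le hρ₀ hρ₁ hM₀ hM₁ hq₀ hq₁ hq₀' hq₁' hb₀ hb₁
  have h3 : 0 ≤ ((ρ₀ ⊗ₖ ρ₁) * (M₀ ⊗ₖ M₁ + q • 1)⁻¹).trace.re :=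
    (hρ₀.1.kronecker hρ₁.1).re_trace_mul_nonneg
      ((hM₀.kronecker hM₁).add_smul_one_posDef hq).inv.posSemidef
  have h4 : (τ * indepState M₀ M₁).trace.re ≤ (1 - q₀) * (1 - q₁) := by
    have g1 := hτσ.re_trace_mul_nonneg hM
    rw [sub_mul, trace_sub, Complex.sub_re, trace_one_kronecker_mul,
      partialTrace_indepState] at g1
    have g2 := hσ.re_trace_mul_nonneg (kronecker_le_smul_one (partialTrace_posSemidef hM₀) hlam
      (by linarith) hN₀ hN₁)
    rw [mul_sub, trace_sub, Complex.sub_re, mul_smul_comm, mul_smul_comm, re_trace_smul,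
      re_trace_smul, mul_one] at g2
    have g3 : (1 - q₀) * (1 - q₁) * σ.trace.re ≤ (1 - q₀) * (1 - q₁) * lam ^ 2 :=
      mul_le_mul_of_nonneg_left hσt (mul_nonneg (by linarith) (by linarith))
    have g4 : 0 < lam ^ 2 := by positivity
    have g5 : lam ^ 2 * (σ * partialTrace M₀ ⊗ₖ partialTrace M₁).trace.re
        ≤ lam ^ 2 * ((1 - q₀) * (1 - q₁)) := by linarith
    have g6 := le_of_mul_le_mul_left g5 g4
    linarith
  have h5 : (τ * (indepState M₀ M₁ + q • 1)).trace.re ≤ 1 := by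
    rw [mul_add, trace_add, Complex.add_re, mul_smul_comm, re_trace_smul, mul_one]
    nlinarith
  exact h1.trans ((mul_le_of_le_one_right h3 h5).trans h2)

end indep

section cq

variable {X E : Type*} [Fintype X] [DecidableEq X] [Fintype E]

/-- The operator on `E` conditioned on the value `x` of the classical register. -/
def classicalBlock (ρ : Matrix (X × E) (X × E) ℂ) (x : X) : Matrix E E ℂ :=
  of fun e e' => ρ (x, e) (x, e')

omit [Fintype X] in
theorem posSemidef_single (x : X) : (single x x (1 : ℂ)).PosSemidef := by
  rw [← diagonal_single, posSemidef_diagonal_iff]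
  intro i
  rw [Pi.single_apply]
  split_ifs <;> simp

theorem IsCQState.isState [DecidableEq E] {ρ : Matrix (X × E) (X × E) ℂ} (h : IsCQState ρ) :
    IsState ρ := by
  obtain ⟨P, ρE, hP, hP1, hE, rfl⟩ := h
  constructor
  · refine posSemidef_sum _ fun x _ => ?_
    exact PosSemidef.smul ((posSemidef_single x).kronecker (hE x).1) (by exact_mod_cast hP x)
  · rw [trace_sum]
    simp only [trace_smul, trace_kronecker, trace_single_eq_same, (hE _).2, mul_one, smul_eq_mul]
    exact_mod_cast hP1

theorem IsCQState.eq_sum_classicalBlock {ρ : Matrix (X × E) (X × E) ℂ} (h : IsCQState ρ) :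
    ρ = ∑ x, single x x (1 : ℂ) ⊗ₖ classicalBlock ρ x := by
  obtain ⟨P, ρE, hP, hP1, hE, rfl⟩ := h
  ext ⟨x, e⟩ ⟨y, e'⟩
  simp only [classicalBlock, Matrix.sum_apply, Matrix.smul_apply, kronecker_apply, of_apply,
    single_apply, smul_eq_mul, ite_mul, one_mul, zero_mul, mul_ite, mul_zero]
  refine Finset.sum_congr rfl fun z _ => ?_
  split_ifs with hz
  · obtain ⟨rfl, rfl⟩ := hz
    simp
  · rfl

omit [Fintype X] [DecidableEq X] [Fintype E] in
theorem classicalBlock_posSemidef {ρ : Matrix (X × E) (X × E) ℂ} (h : ρ.PosSemidef) (x : X) :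
    (classicalBlock ρ x).PosSemidef :=
  h.submatrix fun e => (x, e)

omit [DecidableEq X] in
theorem trace_sum_classicalBlock (ρ : Matrix (X × E) (X × E) ℂ) :
    (∑ x, classicalBlock ρ x).trace = ρ.trace := by
  rw [trace_sum]
  simp [trace, classicalBlock, Fintype.sum_prod_type]

end cq

section entropy

variable {A B : Type*} [Fintype A] [DecidableEq A] [Fintype B] [DecidableEq B]

omit [Fintype A] [DecidableEq B] in
theorem bddBelow_minEntropy_values (ρ : Matrix (A × B) (A × B) ℂ) :
    BddBelow {t : ℝ | ∃ σ : Matrix B B ℂ, σ.PosSemidef ∧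
      ((1 : Matrix A A ℂ) ⊗ₖ σ - ρ).PosSemidef ∧ t = σ.trace.re} := by
  refine ⟨0, ?_⟩
  rintro _ ⟨σ, hσ, -, rfl⟩
  exact hσ.re_trace_nonneg

omit [Fintype A] [DecidableEq B] in
theorem minEntropyValue_nonneg (ρ : Matrix (A × B) (A × B) ℂ) : 0 ≤ minEntropyValue ρ := by
  refine Real.sInf_nonneg ?_
  rintro _ ⟨σ, hσ, -, rfl⟩
  exact hσ.re_trace_nonneg

omit [Fintype A] [DecidableEq B] in
theorem neg_logb_le_minEntropy {τ : Matrix (A × B) (A × B) ℂ} {σ : Matrix B B ℂ}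
    (hσ : σ.PosSemidef) (hτσ : ((1 : Matrix A A ℂ) ⊗ₖ σ - τ).PosSemidef) {lam : ℝ}
    (hlam : σ.trace.re ≤ lam) : ((-Real.logb 2 lam : ℝ) : EReal) ≤ minEntropy τ := by
  unfold minEntropy
  split_ifs with h
  · exact le_top
  · have h1 : minEntropyValue τ ≤ lam :=
      (csInf_le (bddBelow_minEntropy_values τ) ⟨σ, hσ, hτσ, rfl⟩).trans hlam
    have h2 : 0 < minEntropyValue τ := lt_of_le_of_ne (minEntropyValue_nonneg τ) (Ne.symm h)
    exact_mod_cast neg_le_neg (Real.logb_le_logb_of_le one_lt_two h2 h1)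

theorem exists_of_lt_minEntropy {τ : Matrix (A × B) (A × B) ℂ} (hτ : τ.PosSemidef) {α : ℝ}
    (h : (α : EReal) < minEntropy τ) :
    ∃ σ : Matrix B B ℂ, σ.PosSemidef ∧ ((1 : Matrix A A ℂ) ⊗ₖ σ - τ).PosSemidef ∧
      σ.trace.re ≤ 2 ^ (-α) := by
  have hne : {t : ℝ | ∃ σ : Matrix B B ℂ, σ.PosSemidef ∧
      ((1 : Matrix A A ℂ) ⊗ₖ σ - τ).PosSemidef ∧ t = σ.trace.re}.Nonempty := by
    refine ⟨_, τ.trace.re • 1, PosSemidef.one.real_smul hτ.re_trace_nonneg, ?_, rfl⟩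
    rw [kronecker_smul, one_kronecker_one]
    exact hτ.trace_smul_one_sub
  have hlt : minEntropyValue τ < 2 ^ (-α) := by
    unfold minEntropy at h
    split_ifs at h with h0
    · rw [h0]; positivity
    · have h1 : 0 < minEntropyValue τ := lt_of_le_of_ne (minEntropyValue_nonneg τ) (Ne.symm h0)
      have h2 : α < -Real.logb 2 (minEntropyValue τ) := by exact_mod_cast h
      rw [← Real.logb_lt_iff_lt_rpow one_lt_two h1]
      linarith
  obtain ⟨_, ⟨σ, hσ, hτσ, rfl⟩, hlt'⟩ := exists_lt_of_csInf_lt hne hlt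
  exact ⟨σ, hσ, hτσ, hlt'.le⟩

end entropy

end CQ

/-! ### Carrying a smoothed state over to larger systems. -/

section Lift

open Matrix

/-- An isometry on the register preserves products and traces, so `J Z Jᴴ` smooths `J ρ Jᴴ` as well
as `Z` smooths `ρ`. It is used to embed values into the larger alphabet of the output register. -/
theorem le_smoothMinEntropy_of_register_isometry {Y W F : Type*} [Fintype Y] [DecidableEq Y]
    [Fintype W] [DecidableEq W] [Fintype F] [DecidableEq F] {V : Matrix Y W ℂ} (hV : Vᴴ * V = 1)
    {ρ Z : Matrix (W × F) (W × F) ℂ} (hρ : ρ.PosSemidef) (hZ : Z.PosSemidef) {ε lam : ℝ}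
    (hε : 0 ≤ ε) (hF : 1 - ε ^ 2 ≤ (ρ * Z).trace.re ^ 2) (ht : (Z * ρ * Z).trace.re ≤ 1)
    {σ : Matrix F F ℂ} (hσ : σ.PosSemidef)
    (hd : ((1 : Matrix W W ℂ) ⊗ₖ σ - Z * ρ * Z).PosSemidef) (hσt : σ.trace.re ≤ lam) :
    ((-Real.logb 2 lam : ℝ) : EReal) ≤
      smoothMinEntropy ε ((V ⊗ₖ (1 : Matrix F F ℂ)) * ρ * (V ⊗ₖ (1 : Matrix F F ℂ))ᴴ) := by
  set J := V ⊗ₖ (1 : Matrix F F ℂ) with hJ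
  have hJH : Jᴴ = Vᴴ ⊗ₖ (1 : Matrix F F ℂ) := by
    rw [hJ, conjTranspose_kronecker, conjTranspose_one]
  have hJJ : Jᴴ * J = 1 := by
    rw [hJH, hJ, ← mul_kronecker_mul, hV, one_mul, one_kronecker_one]
  have hcomp : ∀ M N : Matrix (W × F) (W × F) ℂ, J * M * Jᴴ * (J * N * Jᴴ) = J * (M * N) * Jᴴ := by
    intro M N
    calc _ = J * M * (Jᴴ * J) * N * Jᴴ := by simp only [Matrix.mul_assoc]
      _ = _ := by rw [hJJ, Matrix.mul_one]; simp only [Matrix.mul_assoc]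
  have htr : ∀ M : Matrix (W × F) (W × F) ℂ, (J * M * Jᴴ).trace = M.trace := by
    intro M
    rw [trace_mul_comm, ← Matrix.mul_assoc, hJJ, Matrix.one_mul]
  have hρJ : (J * ρ * Jᴴ).PosSemidef := hρ.mul_mul_conjTranspose_same J
  have hZJ : (J * Z * Jᴴ).PosSemidef := hZ.mul_mul_conjTranspose_same J
  have hτp : (Z * ρ * Z).PosSemidef := by
    simpa [hZ.1.eq] using hρ.conjTranspose_mul_mul_same Z
  have hτ : J * Z * Jᴴ * (J * ρ * Jᴴ) * (J * Z * Jᴴ) = J * (Z * ρ * Z) * Jᴴ := by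
    rw [hcomp, hcomp]
  have hfid := fidelity_mul_mul_self hρJ hZJ
  rw [hτ, hcomp, htr] at hfid
  have hmem : J * (Z * ρ * Z) * Jᴴ ∈ smoothingBall ε (J * ρ * Jᴴ) := by
    refine ⟨hτp.mul_mul_conjTranspose_same J, ?_, by rw [htr]; exact ht⟩
    unfold cDist
    rw [hfid]
    exact Real.sqrt_le_iff.2 ⟨hε, by linarith⟩
  refine (neg_logb_le_minEntropy hσ ?_ hσt).trans (le_iSup₂_of_le _ hmem le_rfl)
  -- Conjugation yields only `V Vᴴ ⊗ σ`; the complementary projection restores the full identity on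
  -- the register.
  have h1 : (1 - V * Vᴴ).PosSemidef := by
    have h2 := posSemidef_conjTranspose_mul_self (1 - V * Vᴴ)
    convert! h2 using 1
    have h3 : V * Vᴴ * (V * Vᴴ) = V * Vᴴ := by
      rw [Matrix.mul_assoc, ← Matrix.mul_assoc Vᴴ, hV, Matrix.one_mul]
    rw [conjTranspose_sub, conjTranspose_one, conjTranspose_mul, conjTranspose_conjTranspose,
      Matrix.sub_mul, Matrix.mul_sub, Matrix.mul_sub, h3]
    simp
  have h4 := (hd.mul_mul_conjTranspose_same J).add (h1.kronecker hσ)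
  convert! h4 using 1
  rw [Matrix.mul_sub, Matrix.sub_mul, hJH, hJ, ← mul_kronecker_mul, ← mul_kronecker_mul]
  have h5 : (1 - V * Vᴴ) ⊗ₖ σ = 1 ⊗ₖ σ - (V * Vᴴ) ⊗ₖ σ := by
    ext ⟨i, k⟩ ⟨j, l⟩
    simp only [kronecker_apply, Matrix.sub_apply, sub_mul]
  rw [h5]
  simp

section lift

theorem kronecker_finset_sum {l m n p ι : Type*} (A : Matrix l m ℂ) (s : Finset ι)
    (B : ι → Matrix n p ℂ) : A ⊗ₖ (∑ i ∈ s, B i) = ∑ i ∈ s, A ⊗ₖ B i := by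
  ext ⟨i, k⟩ ⟨j, l⟩
  simp only [kronecker_apply, Matrix.sum_apply, Finset.mul_sum]

theorem trace_mul_kronecker_one {C D : Type*} [Fintype C] [Fintype D] [DecidableEq D]
    (P : Matrix (C × D) (C × D) ℂ) (Z : Matrix C C ℂ) :
    (P * (Z ⊗ₖ (1 : Matrix D D ℂ))).trace =
      ((of fun c c' => ∑ d, P (c, d) (c', d)) * Z).trace := by
  simp only [trace, diag_apply, mul_apply, Fintype.sum_prod_type, kronecker_apply, one_apply,
    mul_ite, mul_one, mul_zero, of_apply, Finset.sum_mul, Finset.sum_ite_eq', Finset.mem_univ,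
    if_true]
  refine Finset.sum_congr rfl fun c _ => ?_
  rw [Finset.sum_comm]

variable {X S Y E R F : Type*} [Fintype X] [DecidableEq X] [Fintype S] [DecidableEq S]
  [Fintype Y] [DecidableEq Y] [Fintype E] [DecidableEq E] [Fintype R] [DecidableEq R]
  [Fintype F] [DecidableEq F]

omit [DecidableEq E] in
/-- Adjoining a classical register `S`, arbitrarily correlated, and an independent system `R`
does not decrease the smooth min-entropy. -/
theorem le_smoothMinEntropy_of_adjoin {j : X × S → Y} (hj : Function.Injective j)
    (k : E × R ≃ F) {β : X → S → Matrix F F ℂ} (hβ : ∀ x s, (β x s).PosSemidef)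
    {ρ : Matrix (X × E) (X × E) ℂ} (hρ : IsCQState ρ) {ρR : Matrix R R ℂ} (hρR : IsState ρR)
    (hsum : ∀ x, (∑ s, β x s).submatrix k k = classicalBlock ρ x ⊗ₖ ρR)
    {Z : Matrix (X × E) (X × E) ℂ} (hZ : Z.PosSemidef) {ε lam : ℝ}
    (hε : 0 ≤ ε) (hF : 1 - ε ^ 2 ≤ (ρ * Z).trace.re ^ 2) (ht : (Z * ρ * Z).trace.re ≤ 1)
    {σ : Matrix E E ℂ} (hσ : σ.PosSemidef)
    (hd : ((1 : Matrix X X ℂ) ⊗ₖ σ - Z * ρ * Z).PosSemidef) (hσt : σ.trace.re ≤ lam) :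
    ((-Real.logb 2 lam : ℝ) : EReal) ≤
      smoothMinEntropy ε (∑ x, ∑ s, single (j (x, s)) (j (x, s)) (1 : ℂ) ⊗ₖ β x s) := by
  set V : Matrix Y (X × S) ℂ := of fun y p => if y = j p then 1 else 0 with hV
  have hVV : Vᴴ * V = 1 := by
    ext p p'
    rw [mul_apply, Finset.sum_eq_single (j p)]
    · simp [hV, one_apply, hj.eq_iff]
    · intro y _ hy; simp [hV, hy]
    · simp
  have hVs : ∀ p, V * single p p (1 : ℂ) * Vᴴ = single (j p) (j p) 1 := by
    intro p
    ext y y'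
    rw [mul_apply, Finset.sum_eq_single p, mul_apply, Finset.sum_eq_single p]
    · simp only [hV, single_apply, of_apply, conjTranspose_apply, eq_comm (a := j p)]
      by_cases h1 : y = j p <;> by_cases h2 : y' = j p <;> simp [h1, h2]
    · intro w _ hw; simp [hw.symm]
    · simp
    · intro w _ hw
      rw [mul_apply, Finset.sum_eq_zero, zero_mul]
      intro v _
      simp [hw.symm]
    · simp
  set ρ₂ : Matrix ((X × S) × F) ((X × S) × F) ℂ :=
    ∑ x, ∑ s, single (x, s) (x, s) (1 : ℂ) ⊗ₖ β x s with hρ₂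
  have hbig : (V ⊗ₖ (1 : Matrix F F ℂ)) * ρ₂ * (V ⊗ₖ (1 : Matrix F F ℂ))ᴴ =
      ∑ x, ∑ s, single (j (x, s)) (j (x, s)) (1 : ℂ) ⊗ₖ β x s := by
    simp only [hρ₂, conjTranspose_kronecker, conjTranspose_one, Matrix.mul_sum, Matrix.sum_mul,
      ← mul_kronecker_mul, hVs, Matrix.one_mul, Matrix.mul_one]
  rw [← hbig]
  -- This regrouping makes the smoothing operator a plain tensor product `Z ⊗ 1`.
  set θ : (X × E) × (S × R) ≃ (X × S) × F :=
    (Equiv.prodProdProdComm X E S R).trans (Equiv.prodCongr (Equiv.refl _) k) with hθ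
  have hθa : ∀ x e s r, θ ((x, e), (s, r)) = ((x, s), k (e, r)) := fun _ _ _ _ => rfl
  have hθs : ∀ x e s r, θ.symm ((x, s), k (e, r)) = ((x, e), (s, r)) := fun _ _ _ _ => by
    rw [← hθa, Equiv.symm_apply_apply]
  have hρ₂p : ρ₂.PosSemidef := posSemidef_sum _ fun x _ => posSemidef_sum _ fun s _ =>
    (posSemidef_single _).kronecker (hβ x s)
  set Z' : Matrix ((X × E) × (S × R)) ((X × E) × (S × R)) ℂ := Z ⊗ₖ 1 with hZ'
  set Z₂ := Z'.submatrix θ.symm θ.symm with hZ₂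
  set ρ' := ρ₂.submatrix θ θ with hρ'
  have hρ₂' : ρ₂ = ρ'.submatrix θ.symm θ.symm := by simp [hρ']
  have hZp : Z'.PosSemidef := hZ.kronecker PosSemidef.one
  have hentry : ∀ x e s r x' e' s' r', ρ' ((x, e), (s, r)) ((x', e'), (s', r')) =
      if x = x' ∧ s = s' then β x s (k (e, r)) (k (e', r')) else 0 := by
    intro x e s r x' e' s' r'
    simp only [hρ', submatrix_apply, hθa, hρ₂, Matrix.sum_apply, kronecker_apply, single_apply,
      Prod.mk.injEq, ite_mul, one_mul, zero_mul]
    rw [Finset.sum_eq_single x, Finset.sum_eq_single s]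
    · simp
    · intro b _ hb; simp [hb]
    · simp
    · intro b _ hb; simp [hb]
    · simp
  have hρe : ∀ x e x' e', ρ (x, e) (x', e') =
      if x = x' then classicalBlock ρ x e e' else 0 := by
    intro x e x' e'
    conv_lhs => rw [hρ.eq_sum_classicalBlock]
    simp only [Matrix.sum_apply, kronecker_apply, single_apply, ite_mul, one_mul, zero_mul]
    rw [Finset.sum_eq_single x]
    · simp
    · intro b _ hb; simp [hb]
    · simp
  have hblock : ∀ x e r e' r', ∑ s, β x s (k (e, r)) (k (e', r')) =
      classicalBlock ρ x e e' * ρR r r' := by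
    intro x e r e' r'
    have := congrFun (congrFun (hsum x) (e, r)) (e', r')
    rwa [submatrix_apply, Matrix.sum_apply] at this
  have hpt : ∀ M : Matrix (X × E) (X × E) ℂ,
      (ρ' * (M ⊗ₖ (1 : Matrix (S × R) (S × R) ℂ))).trace = (ρ * M).trace := by
    intro M
    rw [trace_mul_kronecker_one]
    congr 2
    ext ⟨x, e⟩ ⟨x', e'⟩
    simp only [of_apply, Fintype.sum_prod_type, hentry, and_true]
    rw [hρe, Finset.sum_comm]
    split_ifs with hx
    · simp only [hblock]
      rw [← Finset.mul_sum]
      have : ∑ r, ρR r r = 1 := hρR.2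
      rw [this, mul_one]
    · simp
  have hsub : Z₂ * ρ₂ * Z₂ = (Z' * ρ' * Z').submatrix θ.symm θ.symm := by
    rw [hZ₂, hρ₂', submatrix_mul_equiv, submatrix_mul_equiv]
  have hZZ : Z' * Z' = (Z * Z) ⊗ₖ 1 := by
    rw [hZ', ← mul_kronecker_mul, Matrix.one_mul]
  refine le_smoothMinEntropy_of_register_isometry hVV hρ₂p (Z := Z₂) (hZp.submatrix _) hε ?_ ?_
    (σ := (σ ⊗ₖ ρR).submatrix k.symm k.symm) ((hσ.kronecker hρR.1).submatrix _) ?_ ?_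
  · have : (ρ₂ * Z₂).trace = (ρ * Z).trace := by
      rw [hZ₂, hρ₂', submatrix_mul_equiv, trace_submatrix_equiv, hpt]
    rw [this]; exact hF
  · have : (Z₂ * ρ₂ * Z₂).trace = (Z * ρ * Z).trace := by
      rw [hsub, trace_submatrix_equiv, trace_mul_cycle, trace_mul_comm, hZZ, hpt, trace_mul_comm,
        Matrix.mul_assoc, trace_mul_comm, Matrix.mul_assoc, trace_mul_comm]
    rw [this]; exact ht
  · have hD : (ρ ⊗ₖ ((1 : Matrix S S ℂ) ⊗ₖ ρR) - ρ').PosSemidef := by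
      have h1 : (∑ x, ∑ s, single (x, s) (x, s) (1 : ℂ) ⊗ₖ
          (∑ s' ∈ Finset.univ.erase s, β x s')).PosSemidef :=
        posSemidef_sum _ fun x _ => posSemidef_sum _ fun s _ =>
          (posSemidef_single _).kronecker (posSemidef_sum _ fun s' _ => hβ x s')
      have h2 := h1.submatrix θ
      convert! h2 using 1
      ext ⟨⟨x, e⟩, ⟨s, r⟩⟩ ⟨⟨x', e'⟩, ⟨s', r'⟩⟩
      rw [Matrix.sub_apply, hentry]
      simp only [kronecker_apply, submatrix_apply, hθa, Matrix.sum_apply, single_apply, one_apply,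
        Prod.mk.injEq, ite_mul, one_mul, zero_mul]
      rw [Finset.sum_eq_single x, Finset.sum_eq_single s]
      · rw [hρe]
        by_cases hx : x = x'
        · by_cases hs : s = s'
          · subst hx hs
            simp only [if_true, and_self]
            rw [← hblock, ← Finset.add_sum_erase _ _ (Finset.mem_univ s), add_sub_cancel_left]
          · simp [hs]
        · simp [hx]
      · intro b _ hb; simp [hb]
      · simp
      · intro b _ hb; simp [hb]
      · simp
    have h3 := hD.conjTranspose_mul_mul_same Z'
    rw [hZp.1.eq, Matrix.mul_sub, Matrix.sub_mul, hZ', ← mul_kronecker_mul, ← mul_kronecker_mul,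
      Matrix.one_mul, Matrix.mul_one, ← hZ'] at h3
    have h4 := hd.kronecker (PosSemidef.one.kronecker hρR.1 :
      ((1 : Matrix S S ℂ) ⊗ₖ ρR).PosSemidef)
    have h6 : ((1 : Matrix X X ℂ) ⊗ₖ σ - Z * ρ * Z) ⊗ₖ ((1 : Matrix S S ℂ) ⊗ₖ ρR) =
        (1 ⊗ₖ σ) ⊗ₖ (1 ⊗ₖ ρR) - (Z * ρ * Z) ⊗ₖ (1 ⊗ₖ ρR) := by
      ext ⟨i, k⟩ ⟨j, l⟩
      simp only [kronecker_apply, Matrix.sub_apply, sub_mul]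
    rw [h6] at h4
    have h5 := (h3.add h4).submatrix θ.symm
    rw [sub_add_sub_cancel'] at h5
    rw [hsub]
    convert! h5 using 1
    ext a b
    obtain ⟨⟨⟨x, e⟩, ⟨s, r⟩⟩, rfl⟩ := θ.surjective a
    obtain ⟨⟨⟨x', e'⟩, ⟨s', r'⟩⟩, rfl⟩ := θ.surjective b
    simp only [Matrix.sub_apply, submatrix_apply, Equiv.symm_apply_apply, hθa,
      hθs, kronecker_apply, one_apply, Prod.mk.injEq]
    by_cases hx : x = x' <;> by_cases hs : s = s' <;> simp [hx, hs]
  · have h7 : ((σ ⊗ₖ ρR).submatrix k.symm k.symm).trace = σ.trace := by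
      rw [trace_submatrix_equiv, trace_kronecker, hρR.2, mul_one]
    rw [h7]; exact hσt

end lift

end Lift

open Matrix

/-! ### The selected registers and the conclusion. -/

section select

variable {X₀ X₁ E₀ E₁ S : Type*} [Fintype X₀] [DecidableEq X₀] [Fintype X₁] [DecidableEq X₁]
  [Fintype E₀] [DecidableEq E₀] [Fintype E₁] [DecidableEq E₁] [Fintype S] [DecidableEq S]

theorem mapClassical_eq_sum {X Y E : Type*} [Fintype X] [DecidableEq Y] (f : X → Y)
    (ρ : Matrix (X × E) (X × E) ℂ) :
    mapClassical f ρ = ∑ x, single (f x) (f x) (1 : ℂ) ⊗ₖ classicalBlock ρ x := rfl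

omit [Fintype E₀] [DecidableEq E₀] [Fintype E₁] [DecidableEq E₁] [DecidableEq S] in
/-- Tracing out `S₀ S₁` leaves the product of the conditional operators. -/
theorem sum_classicalBlock_of_marginal {ρ₀ : Matrix (X₀ × E₀) (X₀ × E₀) ℂ}
    {ρ₁ : Matrix (X₁ × E₁) (X₁ × E₁) ℂ}
    {ρ : Matrix (((X₀ × X₁) × (S × S)) × (E₀ × E₁)) (((X₀ × X₁) × (S × S)) × (E₀ × E₁)) ℂ}
    (hmarg : mapClassical Prod.fst ρ = indepState ρ₀ ρ₁) (x₀ : X₀) (x₁ : X₁) (e₀ e₀' : E₀)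
    (e₁ e₁' : E₁) :
    ∑ s₀, ∑ s₁, classicalBlock ρ ((x₀, x₁), (s₀, s₁)) (e₀, e₁) (e₀', e₁') =
      classicalBlock ρ₀ x₀ e₀ e₀' * classicalBlock ρ₁ x₁ e₁ e₁' := by
  have h := congrFun (congrFun hmarg ((x₀, x₁), (e₀, e₁))) ((x₀, x₁), (e₀', e₁'))
  have hR : indepState ρ₀ ρ₁ ((x₀, x₁), (e₀, e₁)) ((x₀, x₁), (e₀', e₁')) =
    classicalBlock ρ₀ x₀ e₀ e₀' * classicalBlock ρ₁ x₁ e₁ e₁' := rfl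
  rw [hR, mapClassical_eq_sum, Matrix.sum_apply, Fintype.sum_prod_type,
    Finset.sum_eq_single (x₀, x₁)] at h
  · rw [← h, Fintype.sum_prod_type]
    simp
  · intro b _ hb
    simp [hb]
  · simp

omit [Fintype E₀] [DecidableEq E₀] [Fintype E₁] [DecidableEq E₁] in
theorem mapClassical_selectRegisters_false
    (ρ : Matrix (((X₀ × X₁) × (S × S)) × (E₀ × E₁)) (((X₀ × X₁) × (S × S)) × (E₀ × E₁)) ℂ) :
    mapClassical (selectRegisters false) ρ = ∑ x₁, ∑ s₀,
      single ((Sum.inr x₁, false, s₀) : (X₀ ⊕ X₁) × Bool × S) (Sum.inr x₁, false, s₀) (1 : ℂ) ⊗ₖ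
        ∑ x₀, ∑ s₁, classicalBlock ρ ((x₀, x₁), (s₀, s₁)) := by
  simp only [mapClassical_eq_sum, selectRegisters, Fintype.sum_prod_type, kronecker_finset_sum]
  rw [Finset.sum_comm]
  refine Finset.sum_congr rfl fun x₁ _ => ?_
  rw [Finset.sum_comm]

omit [Fintype E₀] [DecidableEq E₀] [Fintype E₁] [DecidableEq E₁] in
theorem mapClassical_selectRegisters_true
    (ρ : Matrix (((X₀ × X₁) × (S × S)) × (E₀ × E₁)) (((X₀ × X₁) × (S × S)) × (E₀ × E₁)) ℂ) :
    mapClassical (selectRegisters true) ρ = ∑ x₀, ∑ s₁,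
      single ((Sum.inl x₀, true, s₁) : (X₀ ⊕ X₁) × Bool × S) (Sum.inl x₀, true, s₁) (1 : ℂ) ⊗ₖ
        ∑ x₁, ∑ s₀, classicalBlock ρ ((x₀, x₁), (s₀, s₁)) := by
  simp only [mapClassical_eq_sum, selectRegisters, Fintype.sum_prod_type, kronecker_finset_sum]
  refine Finset.sum_congr rfl fun x₀ _ => ?_
  conv_rhs => rw [Finset.sum_comm]
  exact Finset.sum_congr rfl fun x₁ _ => Finset.sum_comm

theorem IsCQState.isState_sum_classicalBlock {X E : Type*} [Fintype X] [DecidableEq X] [Fintype E]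
    [DecidableEq E] {ρ : Matrix (X × E) (X × E) ℂ} (h : IsCQState ρ) :
    IsState (∑ x, classicalBlock ρ x) :=
  ⟨posSemidef_sum _ fun x _ => classicalBlock_posSemidef h.isState.1 x,
    by rw [trace_sum_classicalBlock, h.isState.2]⟩

theorem le_smoothMinEntropy_select_false {ρ₀ : Matrix (X₀ × E₀) (X₀ × E₀) ℂ}
    {ρ₁ : Matrix (X₁ × E₁) (X₁ × E₁) ℂ} (hρ₀ : IsCQState ρ₀) (hρ₁ : IsCQState ρ₁)
    {ρ : Matrix (((X₀ × X₁) × (S × S)) × (E₀ × E₁)) (((X₀ × X₁) × (S × S)) × (E₀ × E₁)) ℂ}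
    (hρ : ρ.PosSemidef) (hmarg : mapClassical Prod.fst ρ = indepState ρ₀ ρ₁)
    {Z : Matrix (X₁ × E₁) (X₁ × E₁) ℂ} (hZ : Z.PosSemidef) {ε lam : ℝ}
    (hε : 0 ≤ ε) (hF : 1 - ε ^ 2 ≤ (ρ₁ * Z).trace.re ^ 2) (ht : (Z * ρ₁ * Z).trace.re ≤ 1)
    {σ : Matrix E₁ E₁ ℂ} (hσ : σ.PosSemidef)
    (hd : ((1 : Matrix X₁ X₁ ℂ) ⊗ₖ σ - Z * ρ₁ * Z).PosSemidef) (hσt : σ.trace.re ≤ lam) :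
    ((-Real.logb 2 lam : ℝ) : EReal) ≤
      smoothMinEntropy ε (mapClassical (selectRegisters false) ρ) := by
  rw [mapClassical_selectRegisters_false]
  refine le_smoothMinEntropy_of_adjoin
    (j := fun p : X₁ × S => ((Sum.inr p.1, false, p.2) : (X₀ ⊕ X₁) × Bool × S)) ?_
    (Equiv.prodComm E₁ E₀) ?_ hρ₁ hρ₀.isState_sum_classicalBlock ?_ hZ hε hF ht hσ hd hσt
  · rintro ⟨x, s⟩ ⟨x', s'⟩ h
    simpa using h
  · exact fun x s => posSemidef_sum _ fun _ _ => posSemidef_sum _ fun _ _ =>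
      classicalBlock_posSemidef hρ _
  · intro x
    ext ⟨e₁, e₀⟩ ⟨e₁', e₀'⟩
    simp only [submatrix_apply, Equiv.prodComm_apply, Prod.swap_prod_mk, Matrix.sum_apply,
      kronecker_apply, Finset.mul_sum]
    rw [Finset.sum_comm]
    refine Finset.sum_congr rfl fun x₀ _ => ?_
    rw [sum_classicalBlock_of_marginal hmarg, mul_comm]

theorem le_smoothMinEntropy_select_true {ρ₀ : Matrix (X₀ × E₀) (X₀ × E₀) ℂ}
    {ρ₁ : Matrix (X₁ × E₁) (X₁ × E₁) ℂ} (hρ₀ : IsCQState ρ₀) (hρ₁ : IsCQState ρ₁)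
    {ρ : Matrix (((X₀ × X₁) × (S × S)) × (E₀ × E₁)) (((X₀ × X₁) × (S × S)) × (E₀ × E₁)) ℂ}
    (hρ : ρ.PosSemidef) (hmarg : mapClassical Prod.fst ρ = indepState ρ₀ ρ₁)
    {Z : Matrix (X₀ × E₀) (X₀ × E₀) ℂ} (hZ : Z.PosSemidef) {ε lam : ℝ}
    (hε : 0 ≤ ε) (hF : 1 - ε ^ 2 ≤ (ρ₀ * Z).trace.re ^ 2) (ht : (Z * ρ₀ * Z).trace.re ≤ 1)
    {σ : Matrix E₀ E₀ ℂ} (hσ : σ.PosSemidef)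
    (hd : ((1 : Matrix X₀ X₀ ℂ) ⊗ₖ σ - Z * ρ₀ * Z).PosSemidef) (hσt : σ.trace.re ≤ lam) :
    ((-Real.logb 2 lam : ℝ) : EReal) ≤
      smoothMinEntropy ε (mapClassical (selectRegisters true) ρ) := by
  rw [mapClassical_selectRegisters_true]
  refine le_smoothMinEntropy_of_adjoin
    (j := fun p : X₀ × S => ((Sum.inl p.1, true, p.2) : (X₀ ⊕ X₁) × Bool × S)) ?_
    (Equiv.refl (E₀ × E₁)) ?_ hρ₀ hρ₁.isState_sum_classicalBlock ?_ hZ hε hF ht hσ hd hσt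
  · rintro ⟨x, s⟩ ⟨x', s'⟩ h
    simpa using h
  · exact fun x s => posSemidef_sum _ fun _ _ => posSemidef_sum _ fun _ _ =>
      classicalBlock_posSemidef hρ _
  · intro x
    ext ⟨e₀, e₁⟩ ⟨e₀', e₁'⟩
    simp only [submatrix_apply, Equiv.refl_apply, Matrix.sum_apply, kronecker_apply,
      Finset.mul_sum]
    rw [Finset.sum_comm]
    refine Finset.sum_congr rfl fun x₁ _ => ?_
    rw [Finset.sum_comm, sum_classicalBlock_of_marginal hmarg]

/-- For `ε ≥ 1` the zero operator lies in the smoothing ball. -/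
theorem smoothMinEntropy_eq_top_of_one_le {A B : Type*} [Fintype A] [DecidableEq A] [Fintype B]
    [DecidableEq B] {ε : ℝ} (hε : 1 ≤ ε) (ρ : Matrix (A × B) (A × B) ℂ) :
    smoothMinEntropy ε ρ = ⊤ := by
  have hmem : (0 : Matrix (A × B) (A × B) ℂ) ∈ smoothingBall ε ρ := by
    refine ⟨PosSemidef.zero, ?_, by simp⟩
    unfold cDist
    refine (Real.sqrt_le_one.2 ?_).trans hε
    linarith [sq_nonneg (fidelity ρ (0 : Matrix (A × B) (A × B) ℂ))]
  have hval : minEntropyValue (0 : Matrix (A × B) (A × B) ℂ) = 0 := by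
    refine le_antisymm ?_ (minEntropyValue_nonneg _)
    exact csInf_le (bddBelow_minEntropy_values _)
      ⟨0, PosSemidef.zero, by simp [PosSemidef.zero], by simp⟩
  refine top_le_iff.1 (le_iSup₂_of_le _ hmem ?_)
  simp [minEntropy, hval]

end select

theorem mainTheorem10 {X₀ X₁ E₀ E₁ : Type*}
    [Fintype X₀] [DecidableEq X₀] [Fintype X₁] [DecidableEq X₁]
    [Fintype E₀] [DecidableEq E₀] [Fintype E₁] [DecidableEq E₁]
    (ε : ℝ) (hε : 0 ≤ ε) (α : ℝ) (ℓ : ℕ)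
    (ρ₀ : Matrix (X₀ × E₀) (X₀ × E₀) ℂ) (hρ₀ : IsCQState ρ₀)
    (ρ₁ : Matrix (X₁ × E₁) (X₁ × E₁) ℂ) (hρ₁ : IsCQState ρ₁)
    (hα : (α : EReal) ≤ smoothMinEntropy (ε ^ 2) (indepState ρ₀ ρ₁))
    (ρ : Matrix (((X₀ × X₁) × (BitString ℓ × BitString ℓ)) × (E₀ × E₁))
      (((X₀ × X₁) × (BitString ℓ × BitString ℓ)) × (E₀ × E₁)) ℂ)
    (hρ : IsCQState ρ) (hmarg : mapClassical Prod.fst ρ = indepState ρ₀ ρ₁) :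
    ∃ d : Bool, ((α / 2 : ℝ) : EReal) ≤
      smoothMinEntropy ε (mapClassical (selectRegisters d) ρ) := by
  rcases le_or_gt 1 ε with hε1 | hε1
  · exact ⟨false, by rw [smoothMinEntropy_eq_top_of_one_le hε1]; exact le_top⟩
  by_contra! hcon
  obtain ⟨γ, hγ, hγα⟩ := EReal.lt_iff_exists_real_btwn.1
    (max_lt (hcon false) (hcon true))
  have hγα' : γ < α / 2 := by exact_mod_cast hγα
  -- The gap `γ < δ` pays for the loss in the dichotomy, and `δ < α / 2` for the supremum and
  -- infimum in the smooth min-entropy.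
  obtain ⟨δ, hγδ, hδα⟩ := exists_between hγα'
  have hlam : (0 : ℝ) < 2 ^ (-δ) := by positivity
  have hlt : (2 : ℝ) ^ (-δ) < 2 ^ (-γ) :=
    Real.rpow_lt_rpow_of_exponent_lt one_lt_two (by linarith)
  have hlog : -Real.logb 2 ((2 : ℝ) ^ (-γ)) = γ := by
    rw [Real.logb_rpow two_pos (by norm_num)]; ring
  have hc : 0 < 1 - ε ^ 2 := by nlinarith
  have h₀ := exists_feasible_or_dual hρ₀.isState.1 hlam hlt hc
  have h₁ := exists_feasible_or_dual hρ₁.isState.1 hlam hlt hc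
  rcases h₀ with ⟨Z, hZ, hF, ht, σ, hσ, hd, hσt⟩ | ⟨M₀, q₀, hM₀, hq₀, hq₀', hN₀, ha₀, hb₀⟩
  · have := le_smoothMinEntropy_select_true hρ₀ hρ₁ hρ.isState.1 hmarg hZ hε hF ht hσ hd hσt
    rw [hlog] at this
    exact absurd (this.trans (le_max_right _ _)) (not_le.2 hγ)
  rcases h₁ with ⟨Z, hZ, hF, ht, σ, hσ, hd, hσt⟩ | ⟨M₁, q₁, hM₁, hq₁, hq₁', hN₁, ha₁, hb₁⟩
  · have := le_smoothMinEntropy_select_false hρ₀ hρ₁ hρ.isState.1 hmarg hZ hε hF ht hσ hd hσt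
    rw [hlog] at this
    exact absurd (this.trans (le_max_left _ _)) (not_le.2 hγ)
  have hα' : ((2 * δ : ℝ) : EReal) < smoothMinEntropy (ε ^ 2) (indepState ρ₀ ρ₁) :=
    lt_of_lt_of_le (by exact_mod_cast (by linarith : 2 * δ < α)) hα
  unfold smoothMinEntropy at hα'
  obtain ⟨τ, hτ⟩ := lt_iSup_iff.1 hα'
  obtain ⟨hτball, hτ⟩ := lt_iSup_iff.1 hτ
  obtain ⟨hτp, hτC, hτ1⟩ := hτball
  obtain ⟨σ, hσ, hτσ, hσt⟩ := exists_of_lt_minEntropy hτp hτ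
  have hpow : (2 : ℝ) ^ (-(2 * δ)) = ((2 : ℝ) ^ (-δ)) ^ 2 := by
    rw [← Real.rpow_natCast, ← Real.rpow_mul two_pos.le]
    congr 1
    push_cast
    ring
  rw [hpow] at hσt
  have hfid := fidelity_sq_indepState_le hρ₀.isState hρ₁.isState hM₀ hM₁ hlam hq₀ hq₁ hq₀' hq₁'
    hN₀ hN₁ hb₀ hb₁ hτp hτ1 hσ hτσ hσt
  -- Membership in the ball gives `F² ≥ 1 - ε⁴`, while both certificates have `1 - aᵢ > ε²`, so `F²
  -- < 1 - ε⁴`.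
  unfold cDist at hτC
  have h2 := (Real.sqrt_le_left (by positivity)).1 hτC
  nlinarith [sq_nonneg ε]
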